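/- Consider the following infinitely repeated game with two players $i\in\{1,2\}$ (write $j$ for the opponent of $i$). A state $\theta\in\Theta=\{H,L\}$ is drawn once and for all, with $\mathbb P[\theta=H]=p_0\in(0,1)$. In every period $t=1,2,\dots$ each player $i$ receives a private signal $x_{it}$ in a finite set $X$ and then chooses an action $a_{it}\in\{I,N\}$ (invest, not invest); past action profiles are publicly observed, stage payoffs are not. Conditional on $\theta$ the signals are independent across players and periods with distribution $f_\theta\in\Delta(X)$, where $f_\theta(x)>0$ for all $\theta,x$ and $f_H\ne f_L$. The stage payoff $u_i(a,\theta)$ is $0$ if $a_i=N$, is $1-c$ if $a=(I,I)$ and $\theta=H$, and is $-c$ in all other cases, where $c\in(0,1)$. Long-run payoffs are $\sum_{t\ge1}(1-\delta)\delta^{t-1}u_i(a_t,\theta)$ with $\delta\in(0,1)$. A private history of player $i$ in period $t$ is $h_{it}=(a^{t-1},x_i^t)$, the past action profiles and $i$'s signals up to period $t$. A pure strategy maps private histories to actions; a mixed strategy is a Borel probability measure on the set of pure strategies (with the product topology); a behavioral strategy maps private histories to $\Delta(\{I,N\})$. A profile $\sigma$ of (mixed or behavioral) strategies induces a probability measure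 $\mathbb P_\sigma$ on the set of paths $\Theta\times(X^2)^\infty\times(\{I,N\}^2)^\infty$; two profiles are outcome equivalent if they induce the same measure. A mixed strategy profile is a Nash equilibrium if no player can increase his expected long-run payoff by deviating to another mixed strategy. A belief function $\mu_i$ assigns to each private history $h_{it}$ a distribution in $\Delta(\Theta\times X^t)$ over the state and the opponent's signals $x_j^t$. For a behavioral profile $\sigma$, let $V_i^\theta(\sigma\mid a^{t-1},x_i^t,x_j^t)$ be the expected discounted payoff of $i$ from period $t$ on, in state $\theta$, at the given history, when players play according to $\sigma$ from then on. A pair $(\sigma,\mu)$ of a behavioral strategy profile and a pair of belief functions is a sequential equilibrium if: 1. (Sequential rationality) for each player $i$, each private history $h_{it}=(a^{t-1},x_i^t)$ and each strategy $\sigma_i'$ of $i$, $$\sum_{(\theta,x_j^t)}\mu_i(h_{it})(\theta,x_j^t)\,V_i^\theta(\sigma\mid a^{t-1},x_i^t,x_j^t)\ \ge\ \sum_{(\theta,x_j^t)}\mu_i(h_{it})(\theta,x_j^t)\,V_i^\theta(\sigma_i',\sigma_{j}\mid a^{t-1},x_i^t,x_j^t);$$ 2. (Consistency) there are completely mixed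 behavioral profiles $\sigma^n$ (assigning positive probability to both actions at all private histories) such that the belief functions $\mu^n$ that they induce by Bayes' rule satisfy $(\mu_i^n(h_{it}),\sigma_i^n(h_{it}))\to(\mu_i(h_{it}),\sigma_i(h_{it}))$ as $n\to\infty$, for each player $i$ and each private history $h_{it}$. Lemma. For every mixed strategy Nash equilibrium $\sigma^*$ of this game there exists a sequential equilibrium $(\sigma^{**},\mu^*)$ such that $\sigma^{**}$ is outcome equivalent to $\sigma^*$. -/

import Mathlib

open MeasureTheory ProbabilityTheory Filter Topology

noncomputable section

namespace InvestmentGame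

/-! Primitives of the game. -/

/-- The payoff-relevant state of nature. -/
inductive State
  | H
  | L
  deriving DecidableEq

/-- The actions: `I` is invest, `N` is not invest. -/
inductive Action
  | I
  | N
  deriving DecidableEq

instance : Fintype State := ⟨{State.H, State.L}, fun θ => by cases θ <;> decide⟩
instance : Fintype Action := ⟨{Action.I, Action.N}, fun a => by cases a <;> decide⟩

instance : MeasurableSpace State := ⊤
instance : DiscreteMeasurableSpace State := ⟨fun _ => trivial⟩
instance : TopologicalSpace Action := ⊥
instance : DiscreteTopology Action := ⟨rfl⟩
instance : MeasurableSpace Action := ⊤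
instance : DiscreteMeasurableSpace Action := ⟨fun _ => trivial⟩

/-- The two players. The opponent of `i` is `1 - i`. -/
abbrev Player : Type := Fin 2

/-- Action profiles. -/
abbrev Profile : Type := Player → Action

/-- The parameters of the game on the finite signal space `X`: the prior probability `p₀` of state
`H`, the cost `c` of investing, the discount factor `δ`, and the full-support signal distributions
`f θ ∈ Δ(X)`, which differ across states. -/
structure Game (X : Type*) [Fintype X] where
  p₀ : ℝ
  c : ℝ
  δ : ℝ
  f : State → stdSimplex ℝ X
  p₀_mem : p₀ ∈ Set.Ioo (0 : ℝ) 1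
  c_mem : c ∈ Set.Ioo (0 : ℝ) 1
  δ_mem : δ ∈ Set.Ioo (0 : ℝ) 1
  f_pos : ∀ θ x, 0 < f θ x
  f_ne : f State.H ≠ f State.L

/-- A private history of a player in period `t` (periods are counted from `0`), before acting: the
`t` past action profiles and the player's own `t + 1` signals. -/
abbrev PrivateHistory (X : Type*) (t : ℕ) : Type _ := (Fin t → Profile) × (Fin (t + 1) → X)

/-- Pure strategies: an action at every private history. -/
abbrev PureStrategy (X : Type*) : Type _ := (Σ t, PrivateHistory X t) → Action

/-- Mixed strategies: probability measures on the set of pure strategies, whose product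
`σ`-algebra is the Borel `σ`-algebra of the product topology (see `borelSpace_pureStrategy`). -/
abbrev MixedStrategy (X : Type*) : Type _ := ProbabilityMeasure (PureStrategy X)

theorem borelSpace_pureStrategy (X : Type*) [Finite X] : BorelSpace (PureStrategy X) := by
  have : BorelSpace Action := ⟨borel_eq_top_of_discrete.symm⟩
  infer_instance

/-- Behavioral strategies: a distribution over actions at every private history. -/
abbrev BehavioralStrategy (X : Type*) : Type _ :=
  (Σ t, PrivateHistory X t) → stdSimplex ℝ Action

/-- Paths of the repeated interaction: the state, the signals of both players in all periods, the
action profiles in all periods. -/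
abbrev Path (X : Type*) : Type _ := State × (ℕ → Player → X) × (ℕ → Profile)

/-- The private history of player `i` in period `t` along a path. -/
def privateHistory {X : Type*} (i : Player) (t : ℕ) (ω : Path X) : PrivateHistory X t :=
  (fun k => ω.2.2 k, fun k => ω.2.1 k i)

/-- The action profiles that result when the players use the pure strategies `s` and receive the
signals `x`. -/
def play {X : Type*} (s : Player → PureStrategy X) (x : ℕ → Player → X) : ℕ → Profile
  | t => fun i => s i ⟨t, fun k : Fin t => play s x k, fun k => x k i⟩
  decreasing_by exact k.2

/-- The probability measure on a finite type given by a point of the simplex. -/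
def simplexMeasure {α : Type*} [Fintype α] [MeasurableSpace α] (p : stdSimplex ℝ α) : Measure α :=
  ∑ a, ENNReal.ofReal (p a) • Measure.dirac a

instance {α : Type*} [Fintype α] [MeasurableSpace α] (p : stdSimplex ℝ α) :
    IsProbabilityMeasure (simplexMeasure p) := by
  constructor
  simp only [simplexMeasure, Measure.coe_finsetSum, Finset.sum_apply, Measure.smul_apply,
    measure_univ, smul_eq_mul, mul_one]
  rw [← ENNReal.ofReal_sum_of_nonneg fun a _ => stdSimplex.zero_le p a, stdSimplex.sum_eq_one,
    ENNReal.ofReal_one]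

/-- The mixed strategy that plays a behavioral strategy: the action at each private history is
drawn from the prescribed distribution, independently across private histories. -/
def BehavioralStrategy.toMixed {X : Type*} (b : BehavioralStrategy X) : MixedStrategy X :=
  ⟨Measure.infinitePi fun h => simplexMeasure (b h), inferInstance⟩

/-- The joint measurability of the actions played, in the strategies and the signals. -/
theorem measurable_play {X : Type*} [Finite X] [MeasurableSpace X] [DiscreteMeasurableSpace X] :
    Measurable fun q : (ℕ → Player → X) × (Player → PureStrategy X) => play q.2 q.1 := by
  refine measurable_pi_lambda _ fun t => ?_
  induction t using Nat.strong_induction_on with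
  | _ t ih =>
    have hh : ∀ i : Player, Measurable
        fun q : (ℕ → Player → X) × (Player → PureStrategy X) =>
          ((fun k : Fin t => play q.2 q.1 k, fun k : Fin (t + 1) => q.1 k i) :
            PrivateHistory X t) := fun i =>
      (measurable_pi_lambda _ fun k : Fin t => ih k k.isLt).prodMk
        (measurable_pi_lambda _ fun k : Fin (t + 1) =>
          (measurable_pi_apply i).comp ((measurable_pi_apply (k : ℕ)).comp measurable_fst))
    have heval : ∀ i : Player, Measurable
        fun r : PrivateHistory X t × (Player → PureStrategy X) => r.2 i ⟨t, r.1⟩ := fun i =>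
      measurable_from_prod_countable_right fun h =>
        (measurable_pi_apply (⟨t, h⟩ : Σ t, PrivateHistory X t)).comp (measurable_pi_apply i)
    refine measurable_pi_lambda _ fun i => ?_
    have := (heval i).comp ((hh i).prodMk measurable_snd)
    convert this using 1
    funext q
    simp only [Function.comp_apply]
    rw [play]

namespace Game

variable {X : Type*} [Fintype X] (G : Game X)

/-- The prior probabilities of the states. -/
def prior : State → ℝ
  | State.H => G.p₀
  | State.L => 1 - G.p₀

/-- The per-period payoff of player `i`. -/
def stagePayoff (i : Player) (a : Profile) (θ : State) : ℝ :=
  match a i, a (1 - i), θ with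
  | Action.N, _, _ => 0
  | Action.I, Action.I, State.H => 1 - G.c
  | Action.I, _, _ => -G.c

section Measures

variable [MeasurableSpace X]

/-- The law of all signals in state `θ`: independent across players and periods, each with
distribution `f θ`. -/
def signalLaw (θ : State) : Measure (ℕ → Player → X) :=
  Measure.infinitePi fun _ => Measure.pi fun _ => simplexMeasure (G.f θ)

/-- The law on paths induced by a mixed strategy profile: the state is drawn from the prior, then
the signals given the state, and the two players draw their pure strategies independently of each
other and of nature. -/
def pathLaw (σ : Player → MixedStrategy X) : Measure (Path X) :=
  ∑ θ, ENNReal.ofReal (G.prior θ) •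
    ((G.signalLaw θ).prod (Measure.pi fun i => (σ i : Measure (PureStrategy X)))).map
      fun q => (θ, q.1, play q.2 q.1)

/-- The long-run expected payoff of player `i` under a mixed strategy profile. -/
def payoff (i : Player) (σ : Player → MixedStrategy X) : ℝ :=
  ∫ ω, ∑' t : ℕ, (1 - G.δ) * G.δ ^ t * G.stagePayoff i (ω.2.2 t) ω.1 ∂G.pathLaw σ

/-- Nash equilibrium in mixed strategies. -/
def IsNash (σ : Player → MixedStrategy X) : Prop :=
  ∀ (i : Player) (τ : MixedStrategy X), G.payoff i (Function.update σ i τ) ≤ G.payoff i σ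

/-- The law on paths induced by a behavioral strategy profile. -/
def behavioralPathLaw (b : Player → BehavioralStrategy X) : Measure (Path X) :=
  G.pathLaw fun i => (b i).toMixed

/-- A mixed and a behavioral strategy profile are outcome equivalent if they induce the same law
on paths. -/
def OutcomeEquivalent (σ : Player → MixedStrategy X) (b : Player → BehavioralStrategy X) : Prop :=
  G.pathLaw σ = G.behavioralPathLaw b

end Measures

/-- The expected payoff of player `i` in period `t + k` in state `θ`, when the past action profiles
are `a`, the signals received by the two players up to period `t` are `x`, and from period `t` on
the players play according to `b`. -/
def expectedStagePayoff (i : Player) (b : Player → BehavioralStrategy X) (θ : State) :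
    (k : ℕ) → {t : ℕ} → (a : Fin t → Profile) → (x : Fin (t + 1) → Player → X) → ℝ
  | 0, t, a, x =>
      ∑ α : Profile, (∏ j, b j ⟨t, a, fun m => x m j⟩ (α j)) * G.stagePayoff i α θ
  | k + 1, t, a, x =>
      ∑ α : Profile, (∏ j, b j ⟨t, a, fun m => x m j⟩ (α j)) *
        ∑ y : Player → X, (∏ j, G.f θ (y j)) *
          expectedStagePayoff i b θ k (Fin.snoc (α := fun _ => Profile) a α)
            (Fin.snoc (α := fun _ => Player → X) x y)

/-- The continuation value of player `i` in state `θ` at the history with past action profiles `a`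
and signals `x` of the two players, if from then on they play according to `b`. -/
def continuationValue (i : Player) (b : Player → BehavioralStrategy X) (θ : State) {t : ℕ}
    (a : Fin t → Profile) (x : Fin (t + 1) → Player → X) : ℝ :=
  ∑' k : ℕ, (1 - G.δ) * G.δ ^ k * G.expectedStagePayoff i b θ k a x

end Game

/-- A belief function of a player: at each private history of period `t`, a distribution over the
state and the signals that the opponent has received up to period `t`. -/
abbrev BeliefFunction (X : Type*) [Fintype X] : Type _ :=
  (h : Σ t, PrivateHistory X t) → stdSimplex ℝ (State × (Fin (h.1 + 1) → X))

/-- The signals of both players, from those of player `i` and those of the opponent. -/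
def joinSignals {X : Type*} {t : ℕ} (i : Player) (own opp : Fin t → X) : Fin t → Player → X :=
  fun k j => if j = i then own k else opp k

/-- A behavioral strategy profile is completely mixed if it assigns positive probability to all
actions at all private histories. -/
def CompletelyMixed {X : Type*} (b : Player → BehavioralStrategy X) : Prop :=
  ∀ i h α, 0 < b i h α

namespace Game

variable {X : Type*} [Fintype X] (G : Game X)

/-- Player `i`'s expected continuation value at the private history `h` under the profile `b` for
the belief `μ` at `h`. -/
def expectedContinuationValue (i : Player) (b : Player → BehavioralStrategy X)
    (h : Σ t, PrivateHistory X t) (μ : stdSimplex ℝ (State × (Fin (h.1 + 1) → X))) : ℝ :=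
  ∑ q : State × (Fin (h.1 + 1) → X),
    μ q * G.continuationValue i b q.1 h.2.1 (joinSignals i h.2.2 q.2)

/-- Sequential rationality of an assessment. -/
def SequentiallyRational (b : Player → BehavioralStrategy X) (μ : Player → BeliefFunction X) :
    Prop :=
  ∀ (i : Player) (h : Σ t, PrivateHistory X t) (τ : BehavioralStrategy X),
    G.expectedContinuationValue i (Function.update b i τ) h (μ i h) ≤
      G.expectedContinuationValue i b h (μ i h)

variable [MeasurableSpace X]

/-- The belief functions `μ` are those induced by the profile `b`: at each private history of
player `i` they are the conditional probabilities, given this history, of the state and the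
opponent's signals. This is meant for completely mixed `b`, for which all private histories have
positive probability. -/
def InducedBeliefs (b : Player → BehavioralStrategy X) (μ : Player → BeliefFunction X) : Prop :=
  ∀ (i : Player) (h : Σ t, PrivateHistory X t) (θ : State) (y : Fin (h.1 + 1) → X),
    μ i h (θ, y) =
      (cond (G.behavioralPathLaw b) {ω | privateHistory i h.1 ω = h.2}).real
        {ω | ω.1 = θ ∧ (privateHistory (1 - i) h.1 ω).2 = y}

/-- Consistency of an assessment: it is the limit of completely mixed strategy profiles together
with the beliefs that they induce. -/
def Consistent (b : Player → BehavioralStrategy X) (μ : Player → BeliefFunction X) : Prop :=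
  ∃ (bs : ℕ → Player → BehavioralStrategy X) (μs : ℕ → Player → BeliefFunction X),
    (∀ n, CompletelyMixed (bs n)) ∧ (∀ n, G.InducedBeliefs (bs n) (μs n)) ∧
    ∀ (i : Player) (h : Σ t, PrivateHistory X t),
      Tendsto (fun n => (μs n i h, bs n i h)) atTop (𝓝 (μ i h, b i h))

/-- Sequential equilibrium. -/
def IsSequentialEquilibrium (b : Player → BehavioralStrategy X) (μ : Player → BeliefFunction X) :
    Prop :=
  G.SequentiallyRational b μ ∧ G.Consistent b μ

end Game

end InvestmentGame

end

/-! Signals have full support and are independent given the state, so a sequence of action profiles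
is off the path exactly when some player's mixed strategy excludes it at all of that player's own
signals (`IsNull`). After such a sequence nobody ever invests again. This is optimal for every
belief: investing alone costs `c`, not investing yields 0, and null sequences stay null when
extended.

What remains are private histories whose action profiles are not null but whose owner has deviated
without being detected, since other own signals would explain the actions. There the opponent's
strategy still has positive weight for some signals, so the belief is determined by Bayes' rule, in
which the own action probabilities cancel. An optimal continuation is prescribed at these histories.
The prescription has no effect on the opponent: it enters only multiplied by the weight zero of the
own past (`IsAdapted.weight_congr`). Hence each player's decision problem is fixed before the
prescriptions are chosen, and no fixed point argument is needed.

The decision problem is `historyProcess`, with unnormalized probabilities so that no conditioning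
occurs. The Nash property, applied to an optimal strategy that does not invest after null sequences,
makes equilibrium play optimal at the root (`payoff_eq_of_isAdapted`, `payoff_update_of_isAdapted`).
Optimality then passes to all nodes reached (`DecisionProcess.value_le_next`), and
`DecisionProcess.value_le_of_agree` glues equilibrium play to the prescribed choices
(`exists_isAdapted_optimal`). Consistent beliefs are limits, by compactness, of Bayesian beliefs
under trembles (`exists_consistent`). -/

noncomputable section

/-! ### Discounted decision processes -/

/-- A decision process with discounting: at each node an action is chosen, which gives a reward and
leads to finitely many successors. Rewards are bounded by the mass of the node, and every action
splits the mass of the node among the successors. -/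
structure DecisionProcess (S A ι : Type*) [Fintype ι] where
  next : S → A → ι → S
  reward : S → A → ℝ
  mass : S → ℝ
  δ : ℝ
  δ_mem : δ ∈ Set.Ioo (0 : ℝ) 1
  mass_next : ∀ s a, ∑ j, mass (next s a j) = mass s
  abs_reward_le : ∀ s a, |reward s a| ≤ mass s

namespace DecisionProcess

variable {S A ι : Type*} [Fintype ι] (D : DecisionProcess S A ι)

theorem one_sub_δ_pos : 0 < 1 - D.δ := sub_pos.2 D.δ_mem.2

variable [Fintype A]

/-- The expected reward after `k` steps. -/
def stage (τ : S → stdSimplex ℝ A) : ℕ → S → ℝ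
  | 0, s => ∑ a, τ s a * D.reward s a
  | k + 1, s => ∑ a, τ s a * ∑ j, stage τ k (D.next s a j)

/-- The discounted value of a strategy. -/
def value (τ : S → stdSimplex ℝ A) (s : S) : ℝ :=
  ∑' k : ℕ, (1 - D.δ) * D.δ ^ k * D.stage τ k s

theorem sum_simplex_mul_const (p : stdSimplex ℝ A) (c : ℝ) : ∑ a, p a * c = c := by
  rw [← Finset.sum_mul, stdSimplex.sum_eq_one, one_mul]

theorem sum_simplex_mul_le {p : stdSimplex ℝ A} {g : A → ℝ} {c : ℝ} (h : ∀ a, g a ≤ c) :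
    ∑ a, p a * g a ≤ c := by
  rw [← sum_simplex_mul_const p c]
  exact Finset.sum_le_sum fun a _ => mul_le_mul_of_nonneg_left (h a) (stdSimplex.zero_le p a)

theorem abs_sum_simplex_mul_le {p : stdSimplex ℝ A} {g : A → ℝ} {c : ℝ} (h : ∀ a, |g a| ≤ c) :
    |∑ a, p a * g a| ≤ c := by
  refine abs_le.2 ⟨?_, sum_simplex_mul_le fun a => (abs_le.1 (h a)).2⟩
  have := sum_simplex_mul_le (p := p) (g := fun a => - g a) (c := c)
    fun a => by linarith [(abs_le.1 (h a)).1]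
  simp only [mul_neg, Finset.sum_neg_distrib] at this
  linarith

theorem abs_stage_le (τ : S → stdSimplex ℝ A) (k : ℕ) (s : S) : |D.stage τ k s| ≤ D.mass s := by
  induction k generalizing s with
  | zero => exact abs_sum_simplex_mul_le fun a => D.abs_reward_le s a
  | succ k ih =>
    refine abs_sum_simplex_mul_le fun a => ?_
    rw [← D.mass_next s a]
    exact (Finset.abs_sum_le_sum_abs _ _).trans (Finset.sum_le_sum fun j _ => ih _)

theorem summable_stage (τ : S → stdSimplex ℝ A) (s : S) :
    Summable fun k : ℕ => (1 - D.δ) * D.δ ^ k * D.stage τ k s := by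
  refine Summable.of_norm_bounded (g := fun k : ℕ => (1 - D.δ) * D.mass s * D.δ ^ k)
    ((summable_geometric_of_lt_one D.δ_mem.1.le D.δ_mem.2).mul_left _) fun k => ?_
  rw [Real.norm_eq_abs, abs_mul, abs_mul, abs_pow, abs_of_pos D.δ_mem.1,
    abs_of_pos D.one_sub_δ_pos, mul_right_comm]
  have := D.abs_stage_le τ k s
  have := D.one_sub_δ_pos
  have := pow_pos D.δ_mem.1 k
  gcongr

theorem abs_value_le (τ : S → stdSimplex ℝ A) (s : S) : |D.value τ s| ≤ D.mass s := by
  have h := (hasSum_geometric_of_lt_one D.δ_mem.1.le D.δ_mem.2).mul_left ((1 - D.δ) * D.mass s)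
  have hne := D.one_sub_δ_pos.ne'
  rw [mul_right_comm, mul_inv_cancel₀ hne, one_mul] at h
  rw [← Real.norm_eq_abs]
  refine tsum_of_norm_bounded h fun k => ?_
  rw [Real.norm_eq_abs, abs_mul, abs_mul, abs_pow, abs_of_pos D.δ_mem.1,
    abs_of_pos D.one_sub_δ_pos, mul_right_comm]
  have := D.abs_stage_le τ k s
  have := D.one_sub_δ_pos
  have := pow_pos D.δ_mem.1 k
  gcongr

/-- The Bellman equation, from splitting off the first term of the series. Successors are summed
without probabilities because these are part of the mass. -/
theorem value_eq (τ : S → stdSimplex ℝ A) (s : S) :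
    D.value τ s = ∑ a, τ s a *
      ((1 - D.δ) * D.reward s a + D.δ * ∑ j, D.value τ (D.next s a j)) := by
  have h1 : ∀ k : ℕ, (1 - D.δ) * D.δ ^ (k + 1) * D.stage τ (k + 1) s = ∑ a, ∑ j,
      τ s a * D.δ * ((1 - D.δ) * D.δ ^ k * D.stage τ k (D.next s a j)) := by
    intro k
    rw [stage, Finset.mul_sum]
    refine Finset.sum_congr rfl fun a _ => ?_
    rw [Finset.mul_sum, Finset.mul_sum]
    exact Finset.sum_congr rfl fun j _ => by ring
  rw [value, (D.summable_stage τ s).tsum_eq_zero_add]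
  simp only [h1]
  rw [Summable.tsum_finsetSum fun a _ => summable_sum fun j _ =>
    (D.summable_stage τ _).mul_left _]
  rw [pow_zero, mul_one, stage, Finset.mul_sum, ← Finset.sum_add_distrib]
  refine Finset.sum_congr rfl fun a _ => ?_
  rw [Summable.tsum_finsetSum fun j _ => (D.summable_stage τ _).mul_left _]
  simp only [tsum_mul_left]
  simp only [value, mul_add, Finset.mul_sum]
  congr 1
  · ring
  · exact Finset.sum_congr rfl fun j _ => by ring

/-- A function that is bounded by a multiple of the mass, and that wherever it is positive is at
most its discounted average over successors, is nowhere positive. -/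
theorem nonpos_of_contraction {g : S → ℝ} {C : ℝ} (hC : ∀ s, g s ≤ C * D.mass s)
    (h : ∀ s, g s ≤ 0 ∨ ∃ p : stdSimplex ℝ A,
      g s ≤ D.δ * ∑ a, p a * ∑ j, g (D.next s a j)) (s : S) : g s ≤ 0 := by
  have hm : ∀ s, ∀ a : A, 0 ≤ D.mass s := fun s a => (abs_nonneg _).trans (D.abs_reward_le s a)
  -- Each use of the hypothesis gains a factor `δ`, since the masses of the successors add up to
  -- that of the node.
  have key : ∀ n : ℕ, ∀ s, g s ≤ D.δ ^ n * (|C| * D.mass s) ∨ g s ≤ 0 := by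
    intro n
    induction n with
    | zero =>
      intro s
      rcases h s with h | ⟨p, -⟩
      · exact Or.inr h
      · have : Nonempty A := by
          by_contra hA
          rw [not_nonempty_iff] at hA
          have := stdSimplex.sum_eq_one p
          simp at this
        left
        rw [pow_zero, one_mul]
        exact (hC s).trans (mul_le_mul_of_nonneg_right (le_abs_self C) (hm s this.some))
    | succ n ih =>
      intro s
      rcases h s with h | ⟨p, hp⟩
      · exact Or.inr h
      · left
        refine hp.trans ?_
        rw [pow_succ', mul_assoc]
        refine mul_le_mul_of_nonneg_left ?_ D.δ_mem.1.le
        refine sum_simplex_mul_le fun a => ?_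
        rw [← D.mass_next s a, Finset.mul_sum, Finset.mul_sum]
        refine Finset.sum_le_sum fun j _ => ?_
        rcases ih (D.next s a j) with h' | h'
        · exact h'
        · exact h'.trans (mul_nonneg (pow_nonneg D.δ_mem.1.le _)
            (mul_nonneg (abs_nonneg _) (hm _ a)))
  by_contra hs
  have hlim : Tendsto (fun n : ℕ => D.δ ^ n * (|C| * D.mass s)) atTop (𝓝 0) := by
    simpa using (tendsto_pow_atTop_nhds_zero_of_lt_one D.δ_mem.1.le D.δ_mem.2).mul_const
      (|C| * D.mass s)
  exact hs (ge_of_tendsto' hlim fun n => (key n s).resolve_right hs)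

/-- The point mass at an action. -/
def pointMass [DecidableEq A] (a : A) : stdSimplex ℝ A := ⟨Pi.single a 1, single_mem_stdSimplex ℝ a⟩

theorem sum_pointMass_mul [DecidableEq A] (a : A) (g : A → ℝ) :
    ∑ a', pointMass a a' * g a' = g a := by
  change ∑ a', (Pi.single a 1 : A → ℝ) a' * g a' = g a
  simp [Pi.single_apply]

/-- There is a strategy that is optimal at all nodes, and that takes prescribed choices on a set of
nodes where these choices are known to be optimal. -/
theorem exists_optimal [DecidableEq A] [Nonempty A] (Z : Set S) (d : S → stdSimplex ℝ A)
    (hd : ∀ s ∈ Z, ∀ τ τ' : S → stdSimplex ℝ A, (∀ s ∈ Z, τ' s = d s) →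
      D.value τ s ≤ D.value τ' s) :
    ∃ τ' : S → stdSimplex ℝ A, (∀ s ∈ Z, τ' s = d s) ∧
      ∀ (τ : S → stdSimplex ℝ A) (s : S), D.value τ s ≤ D.value τ' s := by
  classical
  let opt : S → ℝ := fun s => ⨆ τ : S → stdSimplex ℝ A, D.value τ s
  have hbdd : ∀ s, BddAbove (Set.range fun τ : S → stdSimplex ℝ A => D.value τ s) := fun s =>
    ⟨D.mass s, by rintro _ ⟨τ, rfl⟩; exact (abs_le.1 (D.abs_value_le τ s)).2⟩
  have hle : ∀ (τ : S → stdSimplex ℝ A) s, D.value τ s ≤ opt s := fun τ s => le_ciSup (hbdd s) τ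
  have : Nonempty (S → stdSimplex ℝ A) := ⟨fun _ => pointMass (Classical.arbitrary A)⟩
  let Q : S → A → ℝ := fun s a =>
    (1 - D.δ) * D.reward s a + D.δ * ∑ j, opt (D.next s a j)
  choose best hbest using fun s => Finite.exists_max (Q s)
  have hopt : ∀ s, opt s ≤ Q s (best s) := by
    refine fun s => ciSup_le fun τ => ?_
    rw [value_eq]
    refine sum_simplex_mul_le fun a => le_trans ?_ (hbest s a)
    have := D.δ_mem.1
    dsimp only [Q]
    gcongr with j
    exact hle _ _
  let τ' : S → stdSimplex ℝ A := fun s => if s ∈ Z then d s else pointMass (best s)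
  have hZ : ∀ s ∈ Z, τ' s = d s := fun s hs => if_pos hs
  -- On `Z` the gap between the supremum and the value of `τ'` is closed by `hd`. Elsewhere the
  -- Bellman equation bounds it by `δ` times the gaps at the successors under `best`.
  refine ⟨τ', hZ, fun τ s => (hle τ s).trans (sub_nonpos.1 ?_)⟩
  refine D.nonpos_of_contraction (g := fun s => opt s - D.value τ' s) (C := 2) (fun s => ?_)
    (fun s => ?_) s
  · have h1 : opt s ≤ D.mass s := ciSup_le fun τ => (abs_le.1 (D.abs_value_le τ s)).2
    have h2 := (abs_le.1 (D.abs_value_le τ' s)).1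
    linarith
  · by_cases hs : s ∈ Z
    · exact Or.inl (sub_nonpos.2 (ciSup_le fun τ => hd s hs τ τ' hZ))
    · refine Or.inr ⟨pointMass (best s), ?_⟩
      rw [sum_pointMass_mul]
      have h1 : D.value τ' s = (1 - D.δ) * D.reward s (best s) +
          D.δ * ∑ j, D.value τ' (D.next s (best s) j) := by
        rw [value_eq, show τ' s = pointMass (best s) from if_neg hs, sum_pointMass_mul]
      have h2 := hopt s
      dsimp only [Q] at h2
      rw [Finset.sum_sub_distrib, mul_sub]
      linarith

/-- A strategy that at each node is optimal or chooses as an optimal strategy is optimal. -/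
theorem value_le_of_agree {τ b : S → stdSimplex ℝ A}
    (h : ∀ s, D.value τ s ≤ D.value b s ∨ b s = τ s) (s : S) : D.value τ s ≤ D.value b s := by
  refine sub_nonpos.1 (D.nonpos_of_contraction (g := fun s => D.value τ s - D.value b s) (C := 2)
    (fun s => ?_) (fun s => ?_) s)
  · have h1 := (abs_le.1 (D.abs_value_le τ s)).2
    have h2 := (abs_le.1 (D.abs_value_le b s)).1
    linarith
  · refine (h s).imp sub_nonpos.2 fun hs => ⟨τ s, le_of_eq ?_⟩
    -- With equal choices the current rewards cancel, which leaves the discounted differences at the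
    -- successors.
    rw [D.value_eq τ s, D.value_eq b s, hs, ← Finset.sum_sub_distrib, Finset.mul_sum]
    refine Finset.sum_congr rfl fun a _ => ?_
    rw [Finset.sum_sub_distrib]
    ring

/-- No action improves on an optimal strategy. -/
theorem action_value_le [DecidableEq A] {τ : S → stdSimplex ℝ A}
    (hτ : ∀ (τ' : S → stdSimplex ℝ A) (s : S), D.value τ' s ≤ D.value τ s) (s : S) (a : A) :
    (1 - D.δ) * D.reward s a + D.δ * ∑ j, D.value τ (D.next s a j) ≤ D.value τ s := by
  classical
  by_contra! hlt
  -- The deviation recurs if `s` is visited again, so its value has to be compared with that of `τ`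
  -- at all nodes.
  let c : S → stdSimplex ℝ A := Function.update τ s (pointMass a)
  have hc : D.value c s =
      (1 - D.δ) * D.reward s a + D.δ * ∑ j, D.value c (D.next s a j) := by
    rw [value_eq, show c s = pointMass a from Function.update_self .., sum_pointMass_mul]
  have hle : ∀ s', D.value τ s' - D.value c s' ≤ 0 := by
    refine D.nonpos_of_contraction (C := 2) (fun s' => ?_) (fun s' => Or.inr ?_)
    · have h1 := (abs_le.1 (D.abs_value_le τ s')).2
      have h2 := (abs_le.1 (D.abs_value_le c s')).1
      linarith
    · by_cases hs : s' = s
      · subst hs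
        refine ⟨pointMass a, ?_⟩
        rw [sum_pointMass_mul, Finset.sum_sub_distrib, mul_sub]
        linarith
      · refine ⟨τ s', le_of_eq ?_⟩
        rw [D.value_eq τ s', D.value_eq c s', show c s' = τ s' from Function.update_of_ne hs ..,
          ← Finset.sum_sub_distrib, Finset.mul_sum]
        refine Finset.sum_congr rfl fun a _ => ?_
        rw [Finset.sum_sub_distrib]
        ring
  have h1 : ∑ j, D.value τ (D.next s a j) ≤ ∑ j, D.value c (D.next s a j) :=
    Finset.sum_le_sum fun j _ => sub_nonpos.1 (hle _)
  have h2 := mul_le_mul_of_nonneg_left h1 D.δ_mem.1.le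
  have h3 := hτ c s
  linarith

/-- Optimality is inherited by the successors that a strategy reaches. -/
theorem value_le_next [DecidableEq A] {τ b : S → stdSimplex ℝ A}
    (hτ : ∀ (τ' : S → stdSimplex ℝ A) (s : S), D.value τ' s ≤ D.value τ s) {s : S}
    (hs : D.value τ s ≤ D.value b s) {a : A} (ha : 0 < b s a) (j : ι) :
    D.value τ (D.next s a j) ≤ D.value b (D.next s a j) := by
  let Q : A → ℝ := fun a => (1 - D.δ) * D.reward s a + D.δ * ∑ j, D.value b (D.next s a j)
  have hsum : ∀ a, ∑ j, D.value b (D.next s a j) ≤ ∑ j, D.value τ (D.next s a j) :=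
    fun a => Finset.sum_le_sum fun j _ => hτ b _
  have hQ : ∀ a, Q a ≤ D.value τ s := fun a => by
    have h1 := D.action_value_le hτ s a
    have h2 := mul_le_mul_of_nonneg_left (hsum a) D.δ_mem.1.le
    dsimp only [Q]
    linarith
  -- The average loss is at most zero and no single loss is negative, so actions of positive
  -- probability have no loss.
  have h0 : ∑ a, b s a * (D.value τ s - Q a) ≤ 0 := by
    simp only [mul_sub, Finset.sum_sub_distrib, sum_simplex_mul_const]
    rw [D.value_eq b s] at hs
    dsimp only [Q]
    linarith
  have hnn : ∀ a ∈ Finset.univ, 0 ≤ b s a * (D.value τ s - Q a) := fun a _ =>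
    mul_nonneg (stdSimplex.zero_le _ a) (sub_nonneg.2 (hQ a))
  have h1 := (Finset.sum_eq_zero_iff_of_nonneg hnn).1
    (le_antisymm h0 (Finset.sum_nonneg hnn)) a (Finset.mem_univ a)
  have h2 : D.value τ s = Q a := sub_eq_zero.1 ((mul_eq_zero.1 h1).resolve_left ha.ne')
  have h3 := D.action_value_le hτ s a
  have h4 : ∑ j, D.value b (D.next s a j) = ∑ j, D.value τ (D.next s a j) := by
    refine le_antisymm (hsum a) (le_of_mul_le_mul_left ?_ D.δ_mem.1)
    dsimp only [Q] at h2
    linarith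
  exact ((Finset.sum_eq_sum_iff_of_le fun j _ => hτ b _).1 h4 j (Finset.mem_univ j)).ge

end DecisionProcess

end

/-! ### Probabilities of actions along finite histories -/

noncomputable section

namespace InvestmentGame

variable {X : Type*}

/-- The private history in period `k` of a player with signals `x`, when the action profiles are
`a`. -/
def historyAt {t : ℕ} (a : Fin t → Profile) (x : Fin t → X) (k : Fin t) :
    Σ t, PrivateHistory X t :=
  ⟨k, fun m => a (Fin.castLE k.2.le m), fun m => x (Fin.castLE k.2 m)⟩

theorem historyAt_injective {t : ℕ} (a : Fin t → Profile) (x : Fin t → X) :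
    Function.Injective (historyAt a x) := fun _ _ h =>
  Fin.ext (congrArg Sigma.fst h)

theorem historyAt_snoc_castSucc {t : ℕ} (a : Fin t → Profile) (α : Profile) (x : Fin (t + 1) → X)
    (k : Fin t) : historyAt (Fin.snoc (α := fun _ => Profile) a α) x k.castSucc =
      historyAt a (Fin.init x) k := by
  have h : (fun m : Fin k => Fin.snoc (α := fun _ => Profile) a α
      (Fin.castLE k.castSucc.2.le m)) = fun m => a (Fin.castLE k.2.le m) := by
    funext m
    exact Fin.snoc_castSucc (α := fun _ => Profile) α a (Fin.castLE k.2.le m)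
  exact congrArg (fun z => (⟨k, z, fun m => x (Fin.castLE k.castSucc.2 m)⟩ :
    Σ t, PrivateHistory X t)) h

theorem historyAt_snoc_last {t : ℕ} (a : Fin t → Profile) (α : Profile) (x : Fin (t + 1) → X) :
    historyAt (Fin.snoc (α := fun _ => Profile) a α) x (Fin.last t) = ⟨t, a, x⟩ := by
  have h : (fun m : Fin t => Fin.snoc (α := fun _ => Profile) a α
      (Fin.castLE (Fin.last t).2.le m)) = a := by
    funext m
    exact Fin.snoc_castSucc (α := fun _ => Profile) α a m
  exact congrArg (fun z => (⟨t, z, x⟩ : Σ t, PrivateHistory X t)) h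

/-- The pure strategies of player `i` that play `i`'s part of the action profiles `a`, when the
signals are `x`. -/
def compatible (i : Player) {t : ℕ} (a : Fin t → Profile) (x : Fin t → X) :
    Set (PureStrategy X) :=
  {s | ∀ k, s (historyAt a x k) = a k i}

theorem measurableSet_compatible (i : Player) {t : ℕ} (a : Fin t → Profile) (x : Fin t → X) :
    MeasurableSet (compatible i a x) := by
  have : compatible i a x = ⋂ k, (fun s : PureStrategy X => s (historyAt a x k)) ⁻¹' {a k i} := by
    ext s; simp [compatible]
  rw [this]
  exact MeasurableSet.iInter fun k => measurable_pi_apply _ (MeasurableSet.singleton _)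

/-- The probability that a mixed strategy of player `i` plays `i`'s part of the action profiles
`a`, when the signals are `x`. -/
def mixedWeight (i : Player) (σ : MixedStrategy X) {t : ℕ} (a : Fin t → Profile)
    (x : Fin t → X) : ℝ :=
  (σ : Measure (PureStrategy X)).real (compatible i a x)

/-- The probability that a behavioral strategy of player `i` plays `i`'s part of the action
profiles `a`, when the signals are `x`. -/
def weight (i : Player) (b : BehavioralStrategy X) {t : ℕ} (a : Fin t → Profile)
    (x : Fin t → X) : ℝ :=
  ∏ k, b (historyAt a x k) (a k i)

theorem mixedWeight_nonneg (i : Player) (σ : MixedStrategy X) {t : ℕ} (a : Fin t → Profile)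
    (x : Fin t → X) : 0 ≤ mixedWeight i σ a x := measureReal_nonneg

theorem weight_nonneg (i : Player) (b : BehavioralStrategy X) {t : ℕ} (a : Fin t → Profile)
    (x : Fin t → X) : 0 ≤ weight i b a x := Finset.prod_nonneg fun _ _ => stdSimplex.zero_le _ _

theorem weight_zero (i : Player) (b : BehavioralStrategy X) (a : Fin 0 → Profile)
    (x : Fin 0 → X) : weight i b a x = 1 := by simp [weight]

theorem mixedWeight_zero (i : Player) (σ : MixedStrategy X) (a : Fin 0 → Profile)
    (x : Fin 0 → X) : mixedWeight i σ a x = 1 := by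
  have : compatible i a x = Set.univ := Set.eq_univ_of_forall fun s k => k.elim0
  simp [mixedWeight, this]

theorem weight_snoc (i : Player) (b : BehavioralStrategy X) {t : ℕ} (a : Fin t → Profile)
    (α : Profile) (x : Fin (t + 1) → X) :
    weight i b (Fin.snoc (α := fun _ => Profile) a α) x =
      weight i b a (Fin.init x) * b ⟨t, a, x⟩ (α i) := by
  rw [weight, Fin.prod_univ_castSucc, historyAt_snoc_last, Fin.snoc_last]
  congr 1
  refine Finset.prod_congr rfl fun k _ => ?_
  rw [historyAt_snoc_castSucc, Fin.snoc_castSucc (α := fun _ => Profile)]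

theorem mem_compatible_snoc (i : Player) {t : ℕ} (a : Fin t → Profile)
    (α : Profile) (x : Fin (t + 1) → X) (s : PureStrategy X) :
    s ∈ compatible i (Fin.snoc (α := fun _ => Profile) a α) x ↔
      s ∈ compatible i a (Fin.init x) ∧ s ⟨t, a, x⟩ = α i := by
  simp only [compatible, Set.mem_ofPred_eq, Fin.forall_fin_succ', historyAt_snoc_castSucc,
    historyAt_snoc_last, Fin.snoc_castSucc (α := fun _ => Profile),
    Fin.snoc_last (α := fun _ => Profile)]

theorem mixedWeight_snoc_le (i : Player) (σ : MixedStrategy X) {t : ℕ} (a : Fin t → Profile)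
    (α : Profile) (x : Fin (t + 1) → X) :
    mixedWeight i σ (Fin.snoc (α := fun _ => Profile) a α) x ≤ mixedWeight i σ a (Fin.init x) :=
  measureReal_mono fun s hs => ((mem_compatible_snoc i a α x s).1 hs).1

theorem mixedWeight_snoc_congr (i : Player) (σ : MixedStrategy X) {t : ℕ} (a : Fin t → Profile)
    {α α' : Profile} (h : α i = α' i) (x : Fin (t + 1) → X) :
    mixedWeight i σ (Fin.snoc (α := fun _ => Profile) a α) x =
      mixedWeight i σ (Fin.snoc (α := fun _ => Profile) a α') x := by
  have : compatible i (Fin.snoc (α := fun _ => Profile) a α) x =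
      compatible i (Fin.snoc (α := fun _ => Profile) a α') x := by
    ext s
    rw [mem_compatible_snoc, mem_compatible_snoc, h]
  rw [mixedWeight, this, mixedWeight]

/-- Compatible pure strategies are partitioned by their next action. The opponent's component of `α
c` is free, since compatibility constrains only the actions of `i`. -/
theorem sum_mixedWeight_snoc (i : Player) (σ : MixedStrategy X) {t : ℕ} (a : Fin t → Profile)
    (x : Fin (t + 1) → X) (α : Action → Profile) (hα : ∀ c, α c i = c) :
    ∑ c, mixedWeight i σ (Fin.snoc (α := fun _ => Profile) a (α c)) x =
      mixedWeight i σ a (Fin.init x) := by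
  have h : compatible i a (Fin.init x) =
      ⋃ c, compatible i (Fin.snoc (α := fun _ => Profile) a (α c)) x := by
    ext s
    simp only [Set.mem_iUnion, mem_compatible_snoc, hα]
    exact ⟨fun hs => ⟨_, hs, rfl⟩, fun ⟨_, hs, _⟩ => hs⟩
  rw [mixedWeight, h, measureReal_def, measure_iUnion, tsum_fintype, ENNReal.toReal_sum]
  · rfl
  · exact fun _ _ => measure_ne_top _ _
  · intro c c' hc
    rw [Function.onFun, Set.disjoint_left]
    intro s hs hs'
    rw [mem_compatible_snoc, hα] at hs hs'
    exact hc (hs.2.symm.trans hs'.2)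
  · exact fun c => measurableSet_compatible _ _ _

theorem simplexMeasure_singleton {α : Type*} [Fintype α] [MeasurableSpace α]
    [MeasurableSingletonClass α] (p : stdSimplex ℝ α) (a : α) :
    simplexMeasure p {a} = ENNReal.ofReal (p a) := by
  classical
  simp only [simplexMeasure, Measure.coe_finsetSum, Finset.sum_apply, Measure.smul_apply,
    smul_eq_mul, Measure.dirac_apply]
  rw [Finset.sum_eq_single a (fun b _ hb => by simp [hb]) (fun h => absurd (Finset.mem_univ a) h)]
  simp

/-- Compatibility is a cylinder event with one private history per period, and actions at distinct
private histories are independent. -/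
theorem toMixed_compatible (i : Player) (b : BehavioralStrategy X) {t : ℕ} (a : Fin t → Profile)
    (x : Fin t → X) : mixedWeight i b.toMixed a x = weight i b a x := by
  classical
  let T : (Σ t, PrivateHistory X t) → Set Action := fun h =>
    if hlt : h.1 < t then {a ⟨h.1, hlt⟩ i} else Set.univ
  have hT : ∀ k, T (historyAt a x k) = {a k i} := fun k => dif_pos k.2
  have hs : compatible i a x =
      Set.pi (Finset.univ.map ⟨historyAt a x, historyAt_injective a x⟩ : Finset _) T := by
    ext s
    simp [compatible, Set.mem_pi, hT]
  rw [mixedWeight, hs, measureReal_def]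
  change ((Measure.infinitePi fun h => simplexMeasure (b h)) _).toReal = _
  rw [Measure.infinitePi_pi _ fun h _ => (Set.toFinite (T h)).measurableSet, Finset.prod_map,
    ENNReal.toReal_prod]
  refine Finset.prod_congr rfl fun k _ => ?_
  rw [Function.Embedding.coeFn_mk, hT, simplexMeasure_singleton,
    ENNReal.toReal_ofReal (stdSimplex.zero_le _ _)]

theorem play_eq (s : Player → PureStrategy X) (x : ℕ → Player → X) (t : ℕ) (i : Player) :
    play s x t i = s i ⟨t, fun k : Fin t => play s x k, fun k => x k i⟩ := by
  rw [play]

/-- By induction on the period, the private histories along the play are those along `a`. The event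
thus splits into one condition per player, whence the product form of path probabilities. -/
theorem play_eq_iff (s : Player → PureStrategy X) (x : ℕ → Player → X) {t : ℕ}
    (a : Fin t → Profile) :
    (∀ k : Fin t, play s x k = a k) ↔ ∀ i, s i ∈ compatible i a fun k => x k i := by
  have key : ∀ (k : Fin t) (i : Player), (∀ m : Fin t, m < k → play s x m = a m) →
      play s x k i = s i (historyAt a (fun k => x k i) k) := by
    intro k i h
    rw [play_eq]
    have : (fun m : Fin k => play s x m) = fun m => a (Fin.castLE k.2.le m) :=
      funext fun m => h (Fin.castLE k.2.le m) m.2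
    rw [this]
    rfl
  constructor
  · intro h i k
    rw [← key k i fun m _ => h m, h]
  · intro h k
    induction k using WellFoundedLT.induction with
    | _ k ih =>
      funext i
      rw [key k i ih]
      exact h i k

/-- The state, the signals of the first `n` periods and the actions of the first `t` periods. -/
def truncate (n t : ℕ) (ω : Path X) : State × (Fin n → Player → X) × (Fin t → Profile) :=
  (ω.1, fun k => ω.2.1 k, fun k => ω.2.2 k)

theorem prior_pos [Fintype X] (G : Game X) (θ : State) : 0 < G.prior θ := by
  cases θ
  · exact G.p₀_mem.1
  · exact sub_pos.2 G.p₀_mem.2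

theorem abs_stagePayoff_le [Fintype X] (G : Game X) (i : Player) (a : Profile) (θ : State) :
    |G.stagePayoff i a θ| ≤ 1 := by
  obtain ⟨h0, h1⟩ := G.c_mem
  unfold Game.stagePayoff
  split <;> rw [abs_le] <;> constructor <;> linarith

/-! ### Path laws and payoffs in terms of finite histories -/

section Measures

variable [Fintype X] [MeasurableSpace X] [DiscreteMeasurableSpace X] (G : Game X)

omit [Fintype X] [DiscreteMeasurableSpace X] in
theorem measurable_truncate (n t : ℕ) : Measurable (truncate (X := X) n t) := by
  unfold truncate
  fun_prop

omit [Fintype X] [DiscreteMeasurableSpace X] in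
-- The measurable space is arbitrary so that `ext_of_truncate` can apply this to the identity on
-- paths, with the source carrying the σ-algebra generated by the truncations.
theorem measurable_of_truncate {Ω : Type*} [MeasurableSpace Ω] {F : Ω → Path X}
    (h : ∀ n, Measurable fun ω => truncate n n (F ω)) : Measurable F := by
  have h1 : Measurable fun ω => (F ω).1 := (h 0).fst
  have h2 : ∀ k, Measurable fun ω => (F ω).2.1 k := fun k =>
    (measurable_pi_apply (Fin.last k)).comp (h (k + 1)).snd.fst
  have h3 : ∀ k, Measurable fun ω => (F ω).2.2 k := fun k =>
    (measurable_pi_apply (Fin.last k)).comp (h (k + 1)).snd.snd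
  exact h1.prodMk ((measurable_pi_lambda _ h2).prodMk (measurable_pi_lambda _ h3))

/-- Preimages under truncations form a π-system that generates the σ-algebra, and truncations take
finitely many values. -/
theorem ext_of_truncate {μ ν : Measure (Path X)} [IsFiniteMeasure μ]
    (h : ∀ n c, μ {ω | truncate n n ω = c} = ν {ω | truncate n n ω = c}) : μ = ν := by
  have hmap : ∀ n (T : Set (State × (Fin n → Player → X) × (Fin n → Profile))),
      μ (truncate n n ⁻¹' T) = ν (truncate n n ⁻¹' T) := by
    intro n T
    rw [← Measure.map_apply (measurable_truncate n n) T.toFinite.measurableSet,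
      ← Measure.map_apply (measurable_truncate n n) T.toFinite.measurableSet]
    congr 1
    refine Measure.ext_of_singleton fun c => ?_
    rw [Measure.map_apply (measurable_truncate n n) (MeasurableSet.singleton c),
      Measure.map_apply (measurable_truncate n n) (MeasurableSet.singleton c)]
    exact h n c
  let C : Set (Set (Path X)) := {s | ∃ n T, s = truncate n n ⁻¹' T}
  refine ext_of_generate_finite C ?_ ?_ ?_ ?_
  · apply le_antisymm
    · have hid : @Measurable (Path X) (Path X) (MeasurableSpace.generateFrom C) _ id :=
        @measurable_of_truncate X _ (Path X) (MeasurableSpace.generateFrom C) id fun n T _ =>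
          MeasurableSpace.measurableSet_generateFrom ⟨n, T, rfl⟩
      exact fun s hs => hid hs
    · refine MeasurableSpace.generateFrom_le ?_
      rintro _ ⟨n, T, rfl⟩
      exact measurable_truncate n n T.toFinite.measurableSet
  · rintro _ ⟨n, T, rfl⟩ _ ⟨m, S, rfl⟩ -
    refine ⟨max n m, {c | (c.1, fun k : Fin n => c.2.1 (Fin.castLE (le_max_left n m) k),
      fun k : Fin n => c.2.2 (Fin.castLE (le_max_left n m) k)) ∈ T ∧
      (c.1, fun k : Fin m => c.2.1 (Fin.castLE (le_max_right n m) k),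
      fun k : Fin m => c.2.2 (Fin.castLE (le_max_right n m) k)) ∈ S}, rfl⟩
  · rintro _ ⟨n, T, rfl⟩
    exact hmap n T
  · exact hmap 0 Set.univ

theorem measurable_path (θ : State) : Measurable
    fun q : (ℕ → Player → X) × (Player → PureStrategy X) => ((θ, q.1, play q.2 q.1) : Path X) :=
  measurable_const.prodMk (measurable_fst.prodMk measurable_play)

instance (θ : State) : IsProbabilityMeasure (G.signalLaw θ) := by
  unfold Game.signalLaw; infer_instance

instance (σ : Player → MixedStrategy X) : IsFiniteMeasure (G.pathLaw σ) := by
  constructor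
  simp only [Game.pathLaw, Measure.coe_finsetSum, Finset.sum_apply, Measure.smul_apply,
    smul_eq_mul]
  refine ENNReal.sum_lt_top.2 fun θ _ => ENNReal.mul_lt_top ENNReal.ofReal_lt_top ?_
  rw [Measure.map_apply (measurable_path θ) MeasurableSet.univ]
  exact measure_lt_top _ _

theorem signalLaw_cylinder (θ : State) {n : ℕ} (x : Fin n → Player → X) :
    G.signalLaw θ {ξ | ∀ k : Fin n, ξ k = x k} =
      ENNReal.ofReal (∏ k, ∏ j, G.f θ (x k j)) := by
  classical
  let T : ℕ → Set (Player → X) := fun k => if h : k < n then {x ⟨k, h⟩} else Set.univ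
  have hT : ∀ k : Fin n, T k = {x k} := fun k => dif_pos k.2
  have hs : {ξ : ℕ → Player → X | ∀ k : Fin n, ξ k = x k} =
      Set.pi (Finset.univ.map (Fin.valEmbedding (n := n))) T := by
    ext ξ
    simp only [Set.mem_ofPred_eq, Set.mem_pi, Finset.coe_map, Finset.coe_univ, Set.image_univ,
      Set.forall_mem_range, Fin.valEmbedding_apply, hT, Set.mem_singleton_iff]
  rw [hs, Game.signalLaw, Measure.infinitePi_pi _ fun k _ => (Set.toFinite (T k)).measurableSet,
    Finset.prod_map, ENNReal.ofReal_prod_of_nonneg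
      fun _ _ => Finset.prod_nonneg fun _ _ => stdSimplex.zero_le _ _]
  refine Finset.prod_congr rfl fun k _ => ?_
  rw [Fin.valEmbedding_apply, hT, ← Set.univ_pi_singleton, Measure.pi_pi,
    ENNReal.ofReal_prod_of_nonneg fun _ _ => stdSimplex.zero_le _ _]
  simp only [simplexMeasure_singleton]

/-- The probability of a finite history. -/
def historyProb (G : Game X) (W : Player → ∀ {t : ℕ}, (Fin t → Profile) → (Fin t → X) → ℝ)
  {n t : ℕ} (h : t ≤ n) (c : State × (Fin n → Player → X) × (Fin t → Profile)) : ℝ :=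
  G.prior c.1 * (∏ k, ∏ j, G.f c.1 (c.2.1 k j)) *
    ∏ i, W i c.2.2 fun k => c.2.1 (Fin.castLE h k) i

/-- Nature and the two pure strategies are drawn independently given the state. The lengths `n` and
`t` may differ because a private history contains one more signal than action profiles. -/
theorem pathLaw_truncate (σ : Player → MixedStrategy X) {n t : ℕ} (h : t ≤ n)
    (c : State × (Fin n → Player → X) × (Fin t → Profile)) :
    (G.pathLaw σ).real {ω | truncate n t ω = c} =
      historyProb G (fun i _ => mixedWeight i (σ i)) h c := by
  obtain ⟨θ, x, a⟩ := c
  have hpre : ∀ θ', (fun q : (ℕ → Player → X) × (Player → PureStrategy X) =>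
      ((θ', q.1, play q.2 q.1) : Path X)) ⁻¹' {ω | truncate n t ω = (θ, x, a)} =
      if θ' = θ then {ξ | ∀ k : Fin n, ξ k = x k} ×ˢ
        Set.univ.pi fun i => compatible i a fun k => x (Fin.castLE h k) i else ∅ := by
    intro θ'
    split_ifs with hθ
    · ext ⟨ξ, s⟩
      simp only [truncate, Set.mem_preimage, Set.mem_ofPred_eq, Prod.mk.injEq, hθ, true_and,
        Set.mem_prod, Set.mem_pi, Set.mem_univ, forall_const, funext_iff (f := fun k : Fin n => ξ k),
        funext_iff (f := fun k : Fin t => play s ξ k), play_eq_iff]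
      refine and_congr_right fun hx => forall_congr' fun i => ?_
      rw [show (fun k : Fin t => ξ k i) = fun k => x (Fin.castLE h k) i from
        funext fun k => congrFun (hx (Fin.castLE h k)) i]
    · ext q
      simp [truncate, hθ]
  have hm : MeasurableSet {ω : Path X | truncate n t ω = (θ, x, a)} :=
    measurable_truncate n t (MeasurableSet.singleton _)
  rw [measureReal_def]
  simp only [Game.pathLaw, Measure.coe_finsetSum, Finset.sum_apply, Measure.smul_apply,
    smul_eq_mul, Measure.map_apply (measurable_path _) hm, hpre]
  rw [Finset.sum_eq_single θ (fun θ' _ hθ => by simp [hθ])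
    (fun h => absurd (Finset.mem_univ θ) h), if_pos rfl, Measure.prod_prod, Measure.pi_pi,
    signalLaw_cylinder, ENNReal.toReal_mul, ENNReal.toReal_mul,
    ENNReal.toReal_ofReal (prior_pos G θ).le, ENNReal.toReal_ofReal
      (Finset.prod_nonneg fun _ _ => Finset.prod_nonneg fun _ _ => stdSimplex.zero_le _ _),
    ENNReal.toReal_prod, historyProb, mul_assoc]
  rfl

theorem pathLaw_ext {σ σ' : Player → MixedStrategy X}
    (h : ∀ n (c : State × (Fin n → Player → X) × (Fin n → Profile)),
      historyProb G (fun i _ => mixedWeight i (σ i)) le_rfl c =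
        historyProb G (fun i _ => mixedWeight i (σ' i)) le_rfl c) :
    G.pathLaw σ = G.pathLaw σ' := by
  refine ext_of_truncate fun n c => ?_
  rw [← measureReal_eq_measureReal_iff, pathLaw_truncate G σ le_rfl, h,
    pathLaw_truncate G σ' le_rfl]

/-- Stage payoffs are bounded by 1, so the geometric series dominates and the integral may be taken
termwise. Each term depends on a truncation only. -/
theorem payoff_eq (i : Player) (σ : Player → MixedStrategy X) :
    G.payoff i σ = ∑' t : ℕ, (1 - G.δ) * G.δ ^ t *
      ∑ c : State × (Fin (t + 1) → Player → X) × (Fin (t + 1) → Profile),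
        historyProb G (fun i _ => mixedWeight i (σ i)) le_rfl c *
          G.stagePayoff i (c.2.2 (Fin.last t)) c.1 := by
  have hmeas : ∀ t, Measurable fun ω : Path X => G.stagePayoff i (ω.2.2 t) ω.1 := fun t =>
    (Measurable.of_discrete (f := fun c : State × (Fin (t + 1) → Player → X) ×
      (Fin (t + 1) → Profile) => G.stagePayoff i (c.2.2 (Fin.last t)) c.1)).comp
      (measurable_truncate (t + 1) (t + 1))
  have hb : ∀ t (ω : Path X), ‖(1 - G.δ) * G.δ ^ t * G.stagePayoff i (ω.2.2 t) ω.1‖ ≤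
      (1 - G.δ) * G.δ ^ t := by
    intro t ω
    have h1 : 0 < (1 - G.δ) * G.δ ^ t := mul_pos (sub_pos.2 G.δ_mem.2) (pow_pos G.δ_mem.1 t)
    rw [norm_mul, Real.norm_of_nonneg h1.le]
    exact mul_le_of_le_one_right h1.le (abs_stagePayoff_le G i _ _)
  have hint : ∀ t, Integrable (fun ω : Path X =>
      (1 - G.δ) * G.δ ^ t * G.stagePayoff i (ω.2.2 t) ω.1) (G.pathLaw σ) := fun t =>
    Integrable.of_bound ((hmeas t).const_mul _).aestronglyMeasurable _ (ae_of_all _ (hb t))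
  rw [Game.payoff, ← integral_tsum_of_summable_integral_norm hint]
  · refine tsum_congr fun t => ?_
    rw [integral_const_mul]
    congr 1
    have h1 : ∫ ω, G.stagePayoff i (ω.2.2 t) ω.1 ∂(G.pathLaw σ) =
        ∫ c, G.stagePayoff i (c.2.2 (Fin.last t)) c.1
          ∂((G.pathLaw σ).map (truncate (t + 1) (t + 1))) :=
      (integral_map (f := fun c : State × (Fin (t + 1) → Player → X) ×
        (Fin (t + 1) → Profile) => G.stagePayoff i (c.2.2 (Fin.last t)) c.1)
        (measurable_truncate (t + 1) (t + 1)).aemeasurable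
        (Measurable.of_discrete).aestronglyMeasurable).symm
    rw [h1, integral_fintype (Integrable.of_finite)]
    refine Finset.sum_congr rfl fun c _ => ?_
    rw [map_measureReal_apply (measurable_truncate _ _) (MeasurableSet.singleton c), smul_eq_mul]
    congr 1
    exact pathLaw_truncate G σ le_rfl c
  · refine Summable.of_nonneg_of_le (fun t => integral_nonneg fun ω => norm_nonneg _)
      (fun t => ?_) (((summable_geometric_of_lt_one G.δ_mem.1.le G.δ_mem.2).mul_left
        (1 - G.δ)).mul_right ((G.pathLaw σ).real Set.univ))
    have := norm_integral_le_of_norm_le_const (μ := G.pathLaw σ)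
      (f := fun ω : Path X => ‖(1 - G.δ) * G.δ ^ t * G.stagePayoff i (ω.2.2 t) ω.1‖)
      (ae_of_all _ fun ω => (norm_norm _).trans_le (hb t ω))
    exact (le_abs_self _).trans this

end Measures

end InvestmentGame

end

/-! ### The decision process of one player -/

noncomputable section

namespace InvestmentGame

section Players

/-- The pair with value `α` for player `i` and `β` for the opponent. -/
def pair {A : Type*} (i : Player) (α β : A) : Player → A := fun j => if j = i then α else β

theorem one_sub_ne (i : Player) : 1 - i ≠ i := by fin_cases i <;> decide

theorem eq_or_eq_one_sub (i j : Player) : j = i ∨ j = 1 - i := by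
  fin_cases i <;> fin_cases j <;> decide

@[simp] theorem pair_self {A : Type*} (i : Player) (α β : A) : pair i α β i = α := if_pos rfl

@[simp] theorem pair_opp {A : Type*} (i : Player) (α β : A) : pair i α β (1 - i) = β :=
  if_neg (one_sub_ne i)

theorem pair_eta {A : Type*} (i : Player) (p : Player → A) : pair i (p i) (p (1 - i)) = p := by
  funext j
  rcases eq_or_eq_one_sub i j with rfl | rfl <;> simp

theorem prod_player (i : Player) (g : Player → ℝ) : ∏ j, g j = g i * g (1 - i) := by
  rw [Fin.prod_univ_two]
  fin_cases i
  · rfl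
  · exact mul_comm _ _

/-- A pair of values for the players is a value for `i` and one for the opponent. -/
def pairEquiv (A : Type*) (i : Player) : A × A ≃ (Player → A) where
  toFun p := pair i p.1 p.2
  invFun p := (p i, p (1 - i))
  left_inv p := by simp
  right_inv p := pair_eta i p

theorem sum_pair {A : Type*} [Fintype A] (i : Player) (F : (Player → A) → ℝ) :
    ∑ p, F p = ∑ α, ∑ β, F (pair i α β) := by
  rw [← Fintype.sum_prod_type', ← (pairEquiv A i).sum_comp]
  rfl

theorem sum_snoc {A : Type*} [Fintype A] {n : ℕ} (F : (Fin (n + 1) → A) → ℝ) :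
    ∑ p, F p = ∑ p : Fin n → A, ∑ α, F (Fin.snoc (α := fun _ => A) p α) := by
  rw [Finset.sum_comm, ← Fintype.sum_prod_type', ← (Fin.snocEquiv fun _ => A).sum_comp]
  rfl

theorem prod_snoc {A : Type*} {n : ℕ} (p : Fin n → A) (α : A) (g : A → ℝ) :
    ∏ k, g (Fin.snoc (α := fun _ => A) p α k) = (∏ k, g (p k)) * g α := by
  rw [Fin.prod_univ_castSucc, Fin.snoc_last]
  simp only [Fin.snoc_castSucc (α := fun _ => A)]

theorem sum_joinSignals {X : Type*} [Fintype X] {n : ℕ} (i : Player)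
    (F : (Fin n → Player → X) → ℝ) :
    ∑ ξ, F ξ = ∑ x : Fin n → X, ∑ y : Fin n → X, F (joinSignals i x y) := by
  rw [← Fintype.sum_prod_type',
    ← ((Equiv.arrowProdEquivProdArrow (Fin n) (fun _ => X) (fun _ => X)).symm.trans
      (Equiv.piCongrRight fun _ => pairEquiv X i)).sum_comp]
  rfl

theorem joinSignals_self {X : Type*} {n : ℕ} (i : Player) (x y : Fin n → X) (k : Fin n) :
    joinSignals i x y k i = x k := pair_self i _ _

theorem joinSignals_opp {X : Type*} {n : ℕ} (i : Player) (x y : Fin n → X) (k : Fin n) :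
    joinSignals i x y k (1 - i) = y k := pair_opp i _ _

theorem snoc_joinSignals {X : Type*} {n : ℕ} (i : Player) (x y : Fin n → X) (ξ ζ : X) :
    Fin.snoc (α := fun _ => Player → X) (joinSignals i x y) (pair i ξ ζ) =
      joinSignals i (Fin.snoc (α := fun _ => X) x ξ) (Fin.snoc (α := fun _ => X) y ζ) := by
  funext k
  refine Fin.lastCases ?_ (fun k => ?_) k
  · rw [Fin.snoc_last (α := fun _ => Player → X)]
    funext j
    simp only [joinSignals, Fin.snoc_last (α := fun _ => X), pair]
  · rw [Fin.snoc_castSucc (α := fun _ => Player → X)]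
    funext j
    simp only [joinSignals, Fin.snoc_castSucc (α := fun _ => X)]

end Players

variable {X : Type*}

/-- Weights of the opponent of player `i` along a history: an action of `i` does not affect the
weights, and the actions of the opponent split them. -/
structure IsWeight (i : Player) (w : ∀ t, (Fin t → Profile) → (Fin t → X) → ℝ) : Prop where
  nonneg : ∀ t a x, 0 ≤ w t a x
  sum_snoc : ∀ t (a : Fin t → Profile) (x : Fin (t + 1) → X) (α : Action),
    ∑ β, w (t + 1) (Fin.snoc (α := fun _ => Profile) a (pair i α β)) x = w t a (Fin.init x)

theorem isWeight_weight (i : Player) (b : BehavioralStrategy X) :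
    IsWeight i fun t (a : Fin t → Profile) x => weight (1 - i) b a x where
  nonneg _ := weight_nonneg _ b
  sum_snoc t a x α := by
    simp only [weight_snoc, pair_opp]
    rw [← Finset.mul_sum, stdSimplex.sum_eq_one, mul_one]

theorem prod_update (i : Player) (b : Player → BehavioralStrategy X) (τ : BehavioralStrategy X)
    {t : ℕ} (a : Fin t → Profile) (x y : Fin (t + 1) → X) (p : Profile) :
    ∏ j, Function.update b i τ j ⟨t, a, fun m => joinSignals i x y m j⟩ (p j) =
      τ ⟨t, a, x⟩ (p i) * b (1 - i) ⟨t, a, y⟩ (p (1 - i)) := by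
  rw [prod_player i, Function.update_self, Function.update_of_ne (one_sub_ne i)]
  simp only [joinSignals_self, joinSignals_opp]

theorem abs_sum_prod_mul_le {A : Type*} [Fintype A] {g : Player → stdSimplex ℝ A}
    {F : (Player → A) → ℝ} {c : ℝ} (h : ∀ p, |F p| ≤ c) :
    |∑ p, (∏ j, g j (p j)) * F p| ≤ c := by
  have : ∑ p, (∏ j, g j (p j)) * F p =
      ∑ α, g 0 α * ∑ β, g (1 - 0) β * F (pair 0 α β) := by
    simp only [sum_pair 0, prod_player 0, pair_self, pair_opp, Finset.mul_sum, mul_assoc]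
  rw [this]
  exact DecisionProcess.abs_sum_simplex_mul_le fun α =>
    DecisionProcess.abs_sum_simplex_mul_le fun β => h _

variable [Fintype X] (G : Game X)

theorem abs_expectedStagePayoff_le (i : Player) (b : Player → BehavioralStrategy X) (θ : State)
    (k : ℕ) {t : ℕ} (a : Fin t → Profile) (x : Fin (t + 1) → Player → X) :
    |G.expectedStagePayoff i b θ k a x| ≤ 1 := by
  induction k generalizing t with
  | zero =>
    exact abs_sum_prod_mul_le (g := fun j => b j ⟨t, a, fun m => x m j⟩)
      (F := fun p => G.stagePayoff i p θ) fun p => abs_stagePayoff_le G i p θ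
  | succ k ih =>
    refine abs_sum_prod_mul_le (g := fun j => b j ⟨t, a, fun m => x m j⟩)
      (F := fun p => ∑ y : Player → X, (∏ j, G.f θ (y j)) * G.expectedStagePayoff i b θ k
        (Fin.snoc (α := fun _ => Profile) a p) (Fin.snoc (α := fun _ => Player → X) x y))
      fun p => ?_
    exact abs_sum_prod_mul_le (g := fun _ => G.f θ) (F := fun y => G.expectedStagePayoff i b θ k
      (Fin.snoc (α := fun _ => Profile) a p) (Fin.snoc (α := fun _ => Player → X) x y))
      fun y => ih _ _

theorem summable_expectedStagePayoff (i : Player) (b : Player → BehavioralStrategy X) (θ : State)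
    {t : ℕ} (a : Fin t → Profile) (x : Fin (t + 1) → Player → X) :
    Summable fun k : ℕ => (1 - G.δ) * G.δ ^ k * G.expectedStagePayoff i b θ k a x := by
  refine Summable.of_norm_bounded (g := fun k : ℕ => (1 - G.δ) * G.δ ^ k)
    ((summable_geometric_of_lt_one G.δ_mem.1.le G.δ_mem.2).mul_left _) fun k => ?_
  have h1 : 0 < (1 - G.δ) * G.δ ^ k := mul_pos (sub_pos.2 G.δ_mem.2) (pow_pos G.δ_mem.1 k)
  rw [norm_mul, Real.norm_of_nonneg h1.le]
  exact mul_le_of_le_one_right h1.le (abs_expectedStagePayoff_le G i b θ k a x)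

/-- The probability, up to the weight of the own actions, of the past action profiles `a` and the
own signals `x`, jointly with the state and the signals of the opponent. -/
def jointWeight (w : ∀ t, (Fin t → Profile) → (Fin t → X) → ℝ) {t : ℕ} (a : Fin t → Profile)
    (x : Fin (t + 1) → X) (q : State × (Fin (t + 1) → X)) : ℝ :=
  G.prior q.1 * (∏ k, G.f q.1 (x k)) * (∏ k, G.f q.1 (q.2 k)) * w t a (Fin.init q.2)

theorem prior_mul_prod_pos {n : ℕ} (x : Fin n → X) (q : State × (Fin n → X)) :
    0 < G.prior q.1 * (∏ k, G.f q.1 (x k)) * (∏ k, G.f q.1 (q.2 k)) :=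
  mul_pos (mul_pos (prior_pos G q.1) (Finset.prod_pos fun _ _ => G.f_pos _ _))
    (Finset.prod_pos fun _ _ => G.f_pos _ _)

variable {G} in
theorem jointWeight_nonneg {i : Player} {w : ∀ t, (Fin t → Profile) → (Fin t → X) → ℝ}
    (hw : IsWeight i w) {t : ℕ} (a : Fin t → Profile) (x : Fin (t + 1) → X)
    (q : State × (Fin (t + 1) → X)) : 0 ≤ jointWeight G w a x q :=
  mul_nonneg (prior_mul_prod_pos G x q).le (hw.nonneg _ _ _)

/-- The weight ignores the opponent's newest signal, so one more period contributes only the two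
likelihoods. The case `Φ = 1` shows that mass is split; `Φ` a continuation payoff gives the
induction step for values. -/
theorem sum_jointWeight_snoc (w : ∀ t, (Fin t → Profile) → (Fin t → X) → ℝ) {t : ℕ}
    (a : Fin t → Profile) (α : Profile) (x : Fin (t + 1) → X)
    (Φ : X → State → (Fin (t + 1 + 1) → X) → ℝ) :
    ∑ y, ∑ q : State × (Fin (t + 1 + 1) → X), jointWeight G w
        (Fin.snoc (α := fun _ => Profile) a α) (Fin.snoc (α := fun _ => X) x y) q *
          Φ y q.1 q.2 =
      ∑ q : State × (Fin (t + 1) → X),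
        G.prior q.1 * (∏ k, G.f q.1 (x k)) * (∏ k, G.f q.1 (q.2 k)) *
        w (t + 1) (Fin.snoc (α := fun _ => Profile) a α) q.2 *
        ∑ y, ∑ z, G.f q.1 y * G.f q.1 z * Φ y q.1 (Fin.snoc (α := fun _ => X) q.2 z) := by
  have h1 : ∀ (p : Fin (t + 1) → X) z, Fin.init (Fin.snoc (α := fun _ => X) p z) = p :=
    fun p z => Fin.init_snoc (α := fun _ => X) z p
  have h2 : ∀ θ (p : Fin (t + 1) → X) z, ∏ k, G.f θ (Fin.snoc (α := fun _ => X) p z k) =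
    (∏ k, G.f θ (p k)) * G.f θ z := fun θ p z => prod_snoc p z fun x => G.f θ x
  simp only [Fintype.sum_prod_type]
  rw [Finset.sum_comm]
  refine Finset.sum_congr rfl fun θ _ => ?_
  simp only [sum_snoc (n := t + 1), jointWeight, h1, h2, Finset.mul_sum]
  rw [Finset.sum_comm]
  exact Finset.sum_congr rfl fun p _ => Finset.sum_congr rfl fun y _ =>
    Finset.sum_congr rfl fun z _ => by ring

theorem sum_f_mul_f (θ : State) : ∑ y, ∑ z, G.f θ y * G.f θ z = 1 := by
  simp only [← Finset.mul_sum, stdSimplex.sum_eq_one, mul_one]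

/-- The decision process of player `i` against an opponent with weights `w`. -/
def historyProcess (i : Player) (w : ∀ t, (Fin t → Profile) → (Fin t → X) → ℝ)
    (hw : IsWeight i w) : DecisionProcess (Σ t, PrivateHistory X t) Action (Action × X) where
  next s α p := ⟨s.1 + 1, Fin.snoc (α := fun _ => Profile) s.2.1 (pair i α p.1),
    Fin.snoc (α := fun _ => X) s.2.2 p.2⟩
  reward s α := ∑ q : State × (Fin (s.1 + 1) → X), ∑ β,
    G.prior q.1 * (∏ k, G.f q.1 (s.2.2 k)) * (∏ k, G.f q.1 (q.2 k)) *
      w (s.1 + 1) (Fin.snoc (α := fun _ => Profile) s.2.1 (pair i α β)) q.2 *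
      G.stagePayoff i (pair i α β) q.1
  -- The own action probabilities are left out, so a node reached only by an own deviation keeps its
  -- mass and optimality there has content.
  mass s := ∑ q, jointWeight G w s.2.1 s.2.2 q
  δ := G.δ
  δ_mem := G.δ_mem
  mass_next s α := by
    have h := fun β => sum_jointWeight_snoc G w s.2.1 (pair i α β) s.2.2 fun _ _ _ => 1
    simp only [mul_one, sum_f_mul_f] at h
    rw [Fintype.sum_prod_type]
    simp only [h]
    rw [Finset.sum_comm]
    refine Finset.sum_congr rfl fun q _ => ?_
    rw [← Finset.mul_sum, hw.sum_snoc, jointWeight]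
  abs_reward_le s α := by
    refine (Finset.abs_sum_le_sum_abs _ _).trans (Finset.sum_le_sum fun q _ => ?_)
    refine (Finset.abs_sum_le_sum_abs _ _).trans ?_
    rw [jointWeight, ← hw.sum_snoc s.1 s.2.1 q.2 α, Finset.mul_sum]
    refine Finset.sum_le_sum fun β _ => ?_
    have h1 := mul_nonneg (prior_mul_prod_pos G s.2.2 q).le
      (hw.nonneg (s.1 + 1) (Fin.snoc (α := fun _ => Profile) s.2.1 (pair i α β)) q.2)
    rw [abs_mul, abs_of_nonneg h1]
    exact mul_le_of_le_one_right h1 (abs_stagePayoff_le G i _ _)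

theorem stage_zero (i : Player) (w : ∀ t, (Fin t → Profile) → (Fin t → X) → ℝ)
    (hw : IsWeight i w) (τ : BehavioralStrategy X) {t : ℕ} (a : Fin t → Profile)
    (x : Fin (t + 1) → X) :
    (historyProcess G i w hw).stage τ 0 ⟨t, a, x⟩ = ∑ α, ∑ β, τ ⟨t, a, x⟩ α *
      ∑ q : State × (Fin (t + 1) → X),
        G.prior q.1 * (∏ k, G.f q.1 (x k)) * (∏ k, G.f q.1 (q.2 k)) *
        w (t + 1) (Fin.snoc (α := fun _ => Profile) a (pair i α β)) q.2 *
        G.stagePayoff i (pair i α β) q.1 := by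
  refine Finset.sum_congr rfl fun α _ => ?_
  rw [← Finset.mul_sum, Finset.sum_comm]
  rfl

theorem stage_succ (i : Player) (w : ∀ t, (Fin t → Profile) → (Fin t → X) → ℝ)
    (hw : IsWeight i w) (τ : BehavioralStrategy X) (k : ℕ) {t : ℕ} (a : Fin t → Profile)
    (x : Fin (t + 1) → X) :
    (historyProcess G i w hw).stage τ (k + 1) ⟨t, a, x⟩ = ∑ α, ∑ β, τ ⟨t, a, x⟩ α *
      ∑ y, (historyProcess G i w hw).stage τ k
        ⟨t + 1, Fin.snoc (α := fun _ => Profile) a (pair i α β),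
          Fin.snoc (α := fun _ => X) x y⟩ := by
  refine Finset.sum_congr rfl fun α _ => ?_
  rw [← Finset.mul_sum, Fintype.sum_prod_type]
  rfl

/-- The joint weight absorbs the opponent's action probabilities (`hsnoc`) and the new likelihoods,
so both sides obey the same recursion in `k`. -/
theorem sum_jointWeight_mul_expectedStagePayoff (i : Player) (b : Player → BehavioralStrategy X)
    (τ : BehavioralStrategy X) {w : ∀ t, (Fin t → Profile) → (Fin t → X) → ℝ} (hw : IsWeight i w)
    (hb : ∀ t (a : Fin t → Profile) x, w t a x = weight (1 - i) (b (1 - i)) a x) (k : ℕ)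
    {t : ℕ} (a : Fin t → Profile) (x : Fin (t + 1) → X) :
    ∑ q : State × (Fin (t + 1) → X), jointWeight G w a x q *
      G.expectedStagePayoff i (Function.update b i τ) q.1 k a (joinSignals i x q.2) =
      (historyProcess G i w hw).stage τ k ⟨t, a, x⟩ := by
  have hsnoc : ∀ {t : ℕ} (a : Fin t → Profile) (α β : Action) (z : Fin (t + 1) → X),
      w (t + 1) (Fin.snoc (α := fun _ => Profile) a (pair i α β)) z =
        w t a (Fin.init z) * b (1 - i) ⟨t, a, z⟩ β := by
    intro t a α β z
    rw [hb, hb, weight_snoc, pair_opp]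
  induction k generalizing t with
  | zero =>
    simp only [stage_zero, Game.expectedStagePayoff, prod_update, sum_pair i, pair_self, pair_opp,
      hsnoc, jointWeight, Finset.mul_sum]
    rw [Finset.sum_comm]
    refine Finset.sum_congr rfl fun α _ => ?_
    rw [Finset.sum_comm]
    exact Finset.sum_congr rfl fun β _ => Finset.sum_congr rfl fun q _ => by ring
  | succ k ih =>
    have h := fun α β => sum_jointWeight_snoc G w a (pair i α β) x fun y θ z =>
      G.expectedStagePayoff i (Function.update b i τ) θ k
        (Fin.snoc (α := fun _ => Profile) a (pair i α β))
        (joinSignals i (Fin.snoc (α := fun _ => X) x y) z)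
    simp only [ih] at h
    simp only [stage_succ, h, Game.expectedStagePayoff, prod_update, sum_pair (A := Action) i,
      pair_self, pair_opp, hsnoc]
    simp only [sum_pair (A := X) i, prod_player i, pair_self, pair_opp, snoc_joinSignals,
      jointWeight]
    -- The inner sums are made opaque so that distributing products does not expand them.
    generalize hE : (fun (α β : Action) (q : State × (Fin (t + 1) → X)) =>
      ∑ y, ∑ z, G.f q.1 y * G.f q.1 z * G.expectedStagePayoff i (Function.update b i τ) q.1 k
        (Fin.snoc (α := fun _ => Profile) a (pair i α β))
        (joinSignals i (Fin.snoc (α := fun _ => X) x y) (Fin.snoc (α := fun _ => X) q.2 z))) = E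
    have hE' := fun α β q => congrFun (congrFun (congrFun hE α) β) q
    simp only [hE', Finset.mul_sum]
    rw [Finset.sum_comm]
    refine Finset.sum_congr rfl fun α _ => ?_
    rw [Finset.sum_comm]
    exact Finset.sum_congr rfl fun β _ => Finset.sum_congr rfl fun q _ => by ring

/-- The continuation values of player `i`, weighted by the joint weights, add up to the value in
the decision process. -/
theorem sum_jointWeight_mul_continuationValue (i : Player) (b : Player → BehavioralStrategy X)
    (τ : BehavioralStrategy X) {w : ∀ t, (Fin t → Profile) → (Fin t → X) → ℝ} (hw : IsWeight i w)
    (hb : ∀ t (a : Fin t → Profile) x, w t a x = weight (1 - i) (b (1 - i)) a x)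
    {t : ℕ} (a : Fin t → Profile) (x : Fin (t + 1) → X) :
    ∑ q : State × (Fin (t + 1) → X), jointWeight G w a x q *
      G.continuationValue i (Function.update b i τ) q.1 a (joinSignals i x q.2) =
      (historyProcess G i w hw).value τ ⟨t, a, x⟩ := by
  simp only [Game.continuationValue, ← tsum_mul_left]
  rw [← Summable.tsum_finsetSum fun q _ => (summable_expectedStagePayoff G i _ _ _ _).mul_left _]
  refine tsum_congr fun k => ?_
  rw [← sum_jointWeight_mul_expectedStagePayoff G i b τ hw hb, Finset.mul_sum]
  change _ = ∑ q, (1 - G.δ) * G.δ ^ k * _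
  exact Finset.sum_congr rfl fun q _ => by ring

/-- The sum over the histories of period `t` of the own weight times the stage payoff `k` periods
later depends on `t + k` only. -/
theorem sum_weight_mul_stage_succ (i : Player) {w : ∀ t, (Fin t → Profile) → (Fin t → X) → ℝ}
    (hw : IsWeight i w) (τ : BehavioralStrategy X) (k t : ℕ) :
    ∑ a : Fin t → Profile, ∑ x : Fin (t + 1) → X, weight i τ a (Fin.init x) *
      (historyProcess G i w hw).stage τ (k + 1) ⟨t, a, x⟩ =
    ∑ a : Fin (t + 1) → Profile, ∑ x : Fin (t + 1 + 1) → X, weight i τ a (Fin.init x) *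
      (historyProcess G i w hw).stage τ k ⟨t + 1, a, x⟩ := by
  have h1 : ∀ (p : Fin (t + 1) → X) z, Fin.init (Fin.snoc (α := fun _ => X) p z) = p :=
    fun p z => Fin.init_snoc (α := fun _ => X) z p
  rw [sum_snoc]
  refine Finset.sum_congr rfl fun a _ => ?_
  simp only [stage_succ, sum_pair i, sum_snoc (n := t + 1), h1, weight_snoc, pair_self,
    Finset.mul_sum]
  rw [Finset.sum_comm]
  refine Finset.sum_congr rfl fun α _ => ?_
  rw [Finset.sum_comm]
  exact Finset.sum_congr rfl fun β _ => Finset.sum_congr rfl fun q _ =>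
    Finset.sum_congr rfl fun y _ => by ring

theorem sum_weight_mul_stage (i : Player) {w : ∀ t, (Fin t → Profile) → (Fin t → X) → ℝ}
    (hw : IsWeight i w) (τ : BehavioralStrategy X) (k t : ℕ) :
    ∑ a : Fin t → Profile, ∑ x : Fin (t + 1) → X, weight i τ a (Fin.init x) *
      (historyProcess G i w hw).stage τ k ⟨t, a, x⟩ =
    ∑ x : Fin 1 → X, (historyProcess G i w hw).stage τ (t + k) ⟨0, Fin.elim0, x⟩ := by
  induction t generalizing k with
  | zero =>
    rw [Fintype.sum_eq_single (Fin.elim0 : Fin 0 → Profile)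
      fun a h => absurd (Subsingleton.elim _ _) h]
    simp only [weight_zero, one_mul, zero_add]
  | succ t ih =>
    rw [← sum_weight_mul_stage_succ, ih, Nat.add_right_comm, Nat.add_assoc]

/-- The value of a behavioral strategy at the beginning of the game, as a sum over histories. -/
theorem sum_stage_root (i : Player) {w : ∀ t, (Fin t → Profile) → (Fin t → X) → ℝ}
    (hw : IsWeight i w) (τ : BehavioralStrategy X) (t : ℕ) :
    ∑ x : Fin 1 → X, (historyProcess G i w hw).stage τ t ⟨0, Fin.elim0, x⟩ =
    ∑ c : State × (Fin (t + 1) → Player → X) × (Fin (t + 1) → Profile),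
      G.prior c.1 * (∏ k, ∏ j, G.f c.1 (c.2.1 k j)) *
        (weight i τ c.2.2 (fun k => c.2.1 k i) * w (t + 1) c.2.2 (fun k => c.2.1 k (1 - i)) *
          G.stagePayoff i (c.2.2 (Fin.last t)) c.1) := by
  trans ∑ a : Fin (t + 1) → Profile, ∑ x : Fin (t + 1) → X, ∑ q : State × (Fin (t + 1) → X),
    G.prior q.1 * ((∏ k, G.f q.1 (x k)) * ∏ k, G.f q.1 (q.2 k)) *
      (weight i τ a x * w (t + 1) a q.2 * G.stagePayoff i (a (Fin.last t)) q.1)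
  · have h := sum_weight_mul_stage G i hw τ 0 t
    refine h.symm.trans ?_
    rw [sum_snoc]
    refine Finset.sum_congr rfl fun a _ => ?_
    simp only [stage_zero, sum_pair i, weight_snoc, pair_self, Finset.mul_sum,
      Fin.snoc_last (α := fun _ => Profile)]
    rw [Finset.sum_comm]
    refine Finset.sum_congr rfl fun α _ => ?_
    rw [Finset.sum_comm]
    exact Finset.sum_congr rfl fun β _ => Finset.sum_congr rfl fun x _ =>
      Finset.sum_congr rfl fun q _ => by ring
  · simp only [Fintype.sum_prod_type, sum_joinSignals (X := X) i, prod_player i,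
      joinSignals_self, joinSignals_opp, Finset.prod_mul_distrib]
    refine (Finset.sum_congr rfl fun a _ => Finset.sum_comm).trans ?_
    rw [Finset.sum_comm]
    refine Finset.sum_congr rfl fun θ _ => ?_
    rw [Finset.sum_comm]
    refine Finset.sum_congr rfl fun x _ => ?_
    rw [Finset.sum_comm]

end InvestmentGame

end

/-! ### Behavioral profiles adapted to a mixed profile -/

noncomputable section

namespace InvestmentGame

variable {X : Type*}

theorem exists_eq_snoc {A : Type*} {n : ℕ} (p : Fin (n + 1) → A) :
    ∃ (p' : Fin n → A) (α : A), p = Fin.snoc (α := fun _ => A) p' α :=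
  ⟨Fin.init p, p (Fin.last n), (Fin.snoc_init_self (α := fun _ => A) p).symm⟩

/-- The choice of not investing. -/
abbrev notInvest : stdSimplex ℝ Action := DecisionProcess.pointMass Action.N

theorem notInvest_I : notInvest Action.I = 0 :=
  Pi.single_eq_of_ne (M := fun _ => ℝ) (by decide : Action.I ≠ Action.N) 1

theorem stagePayoff_N [Fintype X] (G : Game X) {i : Player} {a : Profile} (h : a i = Action.N)
    (θ : State) : G.stagePayoff i a θ = 0 := by
  unfold Game.stagePayoff
  rw [h]

theorem stagePayoff_nonpos [Fintype X] (G : Game X) {i : Player} {a : Profile}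
    (h : a (1 - i) = Action.N) (θ : State) : G.stagePayoff i a θ ≤ 0 := by
  have := G.c_mem.1
  unfold Game.stagePayoff
  rw [h]
  cases a i <;> simp [this.le]

/-- The behavioral strategy of player `i` that corresponds to a mixed strategy. -/
def conditional (i : Player) (σ : MixedStrategy X) : BehavioralStrategy X := fun h =>
  if hpos : 0 < mixedWeight i σ h.2.1 (Fin.init h.2.2) then
    -- The opponent's entry in `pair i c c` is a dummy: the weight depends on the last profile
    -- through the action of `i` only.
    ⟨fun c => mixedWeight i σ (Fin.snoc (α := fun _ => Profile) h.2.1 (pair i c c)) h.2.2 /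
        mixedWeight i σ h.2.1 (Fin.init h.2.2),
      fun c => div_nonneg (mixedWeight_nonneg _ _ _ _) hpos.le, by
        rw [← Finset.sum_div, sum_mixedWeight_snoc i σ h.2.1 h.2.2 (fun c => pair i c c)
          fun c => pair_self i c c, div_self hpos.ne']⟩
  else notInvest

/-- The chain rule. It survives a past of weight zero, because a longer history has no larger
weight. -/
theorem mixedWeight_mul_conditional (i : Player) (σ : MixedStrategy X) {t : ℕ}
    (a : Fin t → Profile) (x : Fin (t + 1) → X) (α : Profile) :
    mixedWeight i σ a (Fin.init x) * conditional i σ ⟨t, a, x⟩ (α i) =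
      mixedWeight i σ (Fin.snoc (α := fun _ => Profile) a α) x := by
  by_cases hpos : 0 < mixedWeight i σ a (Fin.init x)
  · have : conditional i σ ⟨t, a, x⟩ (α i) =
        mixedWeight i σ (Fin.snoc (α := fun _ => Profile) a (pair i (α i) (α i))) x /
          mixedWeight i σ a (Fin.init x) := by
      rw [conditional, dif_pos hpos]
      rfl
    rw [this, mul_div_cancel₀ _ hpos.ne']
    exact mixedWeight_snoc_congr i σ a (pair_self i _ _) x
  · have h0 := le_antisymm (not_lt.1 hpos) (mixedWeight_nonneg i σ a (Fin.init x))
    rw [h0, zero_mul]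
    exact le_antisymm (mixedWeight_nonneg _ _ _ _) (h0 ▸ mixedWeight_snoc_le i σ a α x)

/-- The past action profiles have probability zero under the mixed strategy profile. -/
def IsNull (σ : Player → MixedStrategy X) {t : ℕ} (a : Fin t → Profile) : Prop :=
  ∃ i, ∀ x, mixedWeight i (σ i) a x = 0

theorem IsNull.snoc {σ : Player → MixedStrategy X} {t : ℕ} {a : Fin t → Profile}
    (h : IsNull σ a) (α : Profile) : IsNull σ (Fin.snoc (α := fun _ => Profile) a α) := by
  obtain ⟨i, hi⟩ := h
  exact ⟨i, fun x => le_antisymm (hi (Fin.init x) ▸ mixedWeight_snoc_le i (σ i) a α x)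
    (mixedWeight_nonneg _ _ _ _)⟩

/-- A behavioral profile is adapted to a mixed profile if nobody invests after action profiles that
have probability zero, and it agrees with the mixed profile on its path. -/
structure IsAdapted (σ : Player → MixedStrategy X) (b : Player → BehavioralStrategy X) : Prop where
  null : ∀ i t (a : Fin t → Profile) x, IsNull σ a → b i ⟨t, a, x⟩ = notInvest
  onPath : ∀ i t (a : Fin t → Profile) x, ¬ IsNull σ a →
    0 < mixedWeight i (σ i) a (Fin.init x) → b i ⟨t, a, x⟩ = conditional i (σ i) ⟨t, a, x⟩

namespace IsAdapted

variable {σ : Player → MixedStrategy X} {b b' : Player → BehavioralStrategy X}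

/-- Choices left open by `IsAdapted` occur only after a past of own weight zero, which annihilates
them. -/
theorem weight_eq (hb : IsAdapted σ b) (i : Player) {t : ℕ} (a : Fin t → Profile)
    (h : ¬ IsNull σ a) (x : Fin t → X) : weight i (b i) a x = mixedWeight i (σ i) a x := by
  induction t with
  | zero => rw [weight_zero, mixedWeight_zero]
  | succ t ih =>
    obtain ⟨a, α, rfl⟩ := exists_eq_snoc a
    have ha : ¬ IsNull σ a := fun ha => h (ha.snoc α)
    rw [weight_snoc, ih a ha, ← mixedWeight_mul_conditional]
    by_cases hpos : 0 < mixedWeight i (σ i) a (Fin.init x)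
    · rw [hb.onPath i t a x ha hpos]
    · rw [le_antisymm (not_lt.1 hpos) (mixedWeight_nonneg _ _ _ _), zero_mul, zero_mul]

/-- Only the past `a` has to be non-null, so this also covers the profile that first makes the
sequence null. -/
theorem weight_snoc_eq (hb : IsAdapted σ b) (i : Player) {t : ℕ} (a : Fin t → Profile)
    (h : ¬ IsNull σ a) (α : Profile) (x : Fin (t + 1) → X) :
    weight i (b i) (Fin.snoc (α := fun _ => Profile) a α) x =
      mixedWeight i (σ i) (Fin.snoc (α := fun _ => Profile) a α) x := by
  rw [weight_snoc, hb.weight_eq i a h, ← mixedWeight_mul_conditional]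
  by_cases hpos : 0 < mixedWeight i (σ i) a (Fin.init x)
  · rw [hb.onPath i t a x h hpos]
  · rw [le_antisymm (not_lt.1 hpos) (mixedWeight_nonneg _ _ _ _), zero_mul, zero_mul]

/-- This removes the circularity: the choices left open by `IsAdapted` do not change the decision
problem of the opponent. -/
theorem weight_congr (hb : IsAdapted σ b) (hb' : IsAdapted σ b') (i : Player) {t : ℕ}
    (a : Fin t → Profile) (x : Fin t → X) : weight i (b i) a x = weight i (b' i) a x := by
  induction t with
  | zero => rw [weight_zero, weight_zero]
  | succ t ih =>
    obtain ⟨a, α, rfl⟩ := exists_eq_snoc a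
    by_cases h : IsNull σ a
    · rw [weight_snoc, weight_snoc, ih, hb.null i t a x h, hb'.null i t a x h]
    · rw [hb.weight_snoc_eq i a h, hb'.weight_snoc_eq i a h]

/-- After a null sequence the weights of a single player may differ, but both products vanish. -/
theorem prod_weight_eq (hb : IsAdapted σ b) {t : ℕ} (a : Fin t → Profile)
    (x : Player → Fin t → X) :
    ∏ i, weight i (b i) a (x i) = ∏ i, mixedWeight i (σ i) a (x i) := by
  induction t with
  | zero => simp only [weight_zero, mixedWeight_zero]
  | succ t ih =>
    obtain ⟨a, α, rfl⟩ := exists_eq_snoc a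
    by_cases h : IsNull σ a
    · obtain ⟨i, hi⟩ := h
      have h1 := ih a fun j => Fin.init (x j)
      have h2 : ∏ j, mixedWeight j (σ j) a (Fin.init (x j)) = 0 :=
        Finset.prod_eq_zero (Finset.mem_univ i) (hi _)
      rw [h2] at h1
      obtain ⟨j, -, hj⟩ := Finset.prod_eq_zero_iff.1 h1
      obtain ⟨i', hi'⟩ := IsNull.snoc ⟨i, hi⟩ α
      rw [Finset.prod_eq_zero (Finset.mem_univ j) (by rw [weight_snoc, hj, zero_mul]),
        Finset.prod_eq_zero (Finset.mem_univ i') (hi' _)]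
    · exact Finset.prod_congr rfl fun i _ => hb.weight_snoc_eq i a h α (x i)

theorem outcomeEquivalent [Fintype X] [MeasurableSpace X] [DiscreteMeasurableSpace X] (G : Game X)
    (hb : IsAdapted σ b) : G.OutcomeEquivalent σ b := by
  refine pathLaw_ext G fun n c => ?_
  simp only [historyProb, toMixed_compatible]
  rw [hb.prod_weight_eq c.2.2 fun i k => c.2.1 (Fin.castLE le_rfl k) i]

end IsAdapted

/-! ### Continuation play after null sequences -/

section Null

variable [Fintype X] (G : Game X) {σ : Player → MixedStrategy X}
  {b : Player → BehavioralStrategy X}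

/-- The opponent never invests again, and investing alone is costly. -/
theorem expectedStagePayoff_nonpos {i : Player}
    (hb : ∀ t (a : Fin t → Profile) x, IsNull σ a → b (1 - i) ⟨t, a, x⟩ = notInvest) (θ : State)
    (k : ℕ) {t : ℕ} (a : Fin t → Profile) (h : IsNull σ a) (x : Fin (t + 1) → Player → X) :
    G.expectedStagePayoff i b θ k a x ≤ 0 := by
  induction k generalizing t with
  | zero =>
    refine Finset.sum_nonpos fun p _ => ?_
    cases hp : p (1 - i) with
    | I =>
      rw [prod_player i, hp, hb t a _ h, notInvest_I, mul_zero, zero_mul]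
    | N =>
      exact mul_nonpos_of_nonneg_of_nonpos
        (Finset.prod_nonneg fun _ _ => stdSimplex.zero_le _ _) (stagePayoff_nonpos G hp θ)
  | succ k ih =>
    refine Finset.sum_nonpos fun p _ => mul_nonpos_of_nonneg_of_nonpos
      (Finset.prod_nonneg fun _ _ => stdSimplex.zero_le _ _) ?_
    exact Finset.sum_nonpos fun y _ => mul_nonpos_of_nonneg_of_nonpos
      (Finset.prod_nonneg fun _ _ => stdSimplex.zero_le _ _) (ih _ (h.snoc p) _)

theorem expectedStagePayoff_eq_zero {i : Player}
    (hb : ∀ t (a : Fin t → Profile) x, IsNull σ a → b i ⟨t, a, x⟩ = notInvest) (θ : State)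
    (k : ℕ) {t : ℕ} (a : Fin t → Profile) (h : IsNull σ a) (x : Fin (t + 1) → Player → X) :
    G.expectedStagePayoff i b θ k a x = 0 := by
  induction k generalizing t with
  | zero =>
    refine Finset.sum_eq_zero fun p _ => ?_
    cases hp : p i with
    | I =>
      rw [prod_player i, hp, hb t a _ h, notInvest_I, zero_mul, zero_mul]
    | N => rw [stagePayoff_N G hp, mul_zero]
  | succ k ih =>
    refine Finset.sum_eq_zero fun p _ => ?_
    rw [Finset.sum_eq_zero fun y _ => by rw [ih _ (h.snoc p), mul_zero], mul_zero]

theorem continuationValue_nonpos {i : Player}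
    (hb : ∀ t (a : Fin t → Profile) x, IsNull σ a → b (1 - i) ⟨t, a, x⟩ = notInvest) (θ : State)
    {t : ℕ} (a : Fin t → Profile) (h : IsNull σ a) (x : Fin (t + 1) → Player → X) :
    G.continuationValue i b θ a x ≤ 0 :=
  tsum_nonpos fun k => mul_nonpos_of_nonneg_of_nonpos
    (mul_nonneg (sub_pos.2 G.δ_mem.2).le (pow_nonneg G.δ_mem.1.le k))
    (expectedStagePayoff_nonpos G hb θ k a h x)

theorem continuationValue_eq_zero {i : Player}
    (hb : ∀ t (a : Fin t → Profile) x, IsNull σ a → b i ⟨t, a, x⟩ = notInvest) (θ : State)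
    {t : ℕ} (a : Fin t → Profile) (h : IsNull σ a) (x : Fin (t + 1) → Player → X) :
    G.continuationValue i b θ a x = 0 := by
  simp only [Game.continuationValue, expectedStagePayoff_eq_zero G hb θ _ a h x, mul_zero,
    tsum_zero]

end Null

/-! ### Payoffs in the game as values at the root -/

section Payoff

variable [Fintype X] [MeasurableSpace X] [DiscreteMeasurableSpace X] (G : Game X)
  {σ : Player → MixedStrategy X} {b : Player → BehavioralStrategy X}

/-- The stage payoff is kept as a factor in `h`, so that the weights need to agree only where it is
nonzero. -/
theorem payoff_eq_sum_value (i : Player) {w : ∀ t, (Fin t → Profile) → (Fin t → X) → ℝ}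
    (hw : IsWeight i w) (τ : BehavioralStrategy X) (ρ : Player → MixedStrategy X)
    (h : ∀ t (a : Fin (t + 1) → Profile) (x : Player → Fin (t + 1) → X) θ,
      (∏ j, mixedWeight j (ρ j) a (x j)) * G.stagePayoff i (a (Fin.last t)) θ =
        weight i τ a (x i) * w (t + 1) a (x (1 - i)) * G.stagePayoff i (a (Fin.last t)) θ) :
    G.payoff i ρ = ∑ x : Fin 1 → X, (historyProcess G i w hw).value τ ⟨0, Fin.elim0, x⟩ := by
  simp only [DecisionProcess.value]
  rw [payoff_eq, ← Summable.tsum_finsetSum fun x _ => DecisionProcess.summable_stage _ _ _]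
  refine tsum_congr fun t => ?_
  rw [← Finset.mul_sum, sum_stage_root]
  change _ = (1 - G.δ) * G.δ ^ t * _
  congr 1
  refine Finset.sum_congr rfl fun c _ => ?_
  rw [historyProb, mul_assoc]
  congr 1
  exact h t c.2.2 (fun j k => c.2.1 k j) c.1

theorem payoff_eq_of_isAdapted (hb : IsAdapted σ b) (i : Player)
    {w : ∀ t, (Fin t → Profile) → (Fin t → X) → ℝ} (hw : IsWeight i w)
    (hwb : ∀ t (a : Fin t → Profile) x, w t a x = weight (1 - i) (b (1 - i)) a x) :
    G.payoff i σ = ∑ x : Fin 1 → X, (historyProcess G i w hw).value (b i) ⟨0, Fin.elim0, x⟩ := by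
  refine payoff_eq_sum_value G i hw (b i) σ fun t a x θ => ?_
  rw [← hb.prod_weight_eq, prod_player i, hwb]

/-- After a null sequence the opponent's mixed and behavioral strategies may differ, but `τ` does
not invest there and earns 0 against both. Elsewhere the opponent's weights agree. -/
theorem payoff_update_of_isAdapted (hb : IsAdapted σ b) (i : Player)
    {w : ∀ t, (Fin t → Profile) → (Fin t → X) → ℝ} (hw : IsWeight i w)
    (hwb : ∀ t (a : Fin t → Profile) x, w t a x = weight (1 - i) (b (1 - i)) a x)
    {τ : BehavioralStrategy X}
    (hτ : ∀ t (a : Fin t → Profile) x, IsNull σ a → τ ⟨t, a, x⟩ = notInvest) :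
    G.payoff i (Function.update σ i τ.toMixed) =
      ∑ x : Fin 1 → X, (historyProcess G i w hw).value τ ⟨0, Fin.elim0, x⟩ := by
  refine payoff_eq_sum_value G i hw τ _ fun t a x θ => ?_
  obtain ⟨a, α, rfl⟩ := exists_eq_snoc a
  rw [prod_player i, Function.update_self, Function.update_of_ne (one_sub_ne i),
    toMixed_compatible, hwb, Fin.snoc_last (α := fun _ => Profile)]
  by_cases h : IsNull σ a
  · cases hα : α i with
    | I => rw [weight_snoc i τ, hα, hτ t a _ h, notInvest_I, mul_zero, zero_mul, zero_mul, zero_mul, zero_mul]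
    | N => rw [stagePayoff_N G hα, mul_zero, mul_zero]
  · rw [hb.weight_snoc_eq _ a h]

end Payoff

/-! ### From Nash equilibrium to optimality at all histories -/

section Equilibrium

variable [Fintype X] (G : Game X)

/-- There is a behavioral profile that is adapted to a Nash equilibrium and optimal at all
histories. -/
theorem exists_isAdapted_optimal [MeasurableSpace X] [DiscreteMeasurableSpace X]
    {σ : Player → MixedStrategy X} (hσ : G.IsNash σ) :
    ∃ b : Player → BehavioralStrategy X, IsAdapted σ b ∧
      ∀ i (τ : BehavioralStrategy X) s,
        (historyProcess G i _ (isWeight_weight i (b (1 - i)))).value τ s ≤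
          (historyProcess G i _ (isWeight_weight i (b (1 - i)))).value (b i) s := by
  classical
  have : Nonempty Action := ⟨Action.N⟩
  -- Any adapted profile would do: it serves to fix the weights in the decision processes.
  let b₀ : Player → BehavioralStrategy X := fun i h =>
    if IsNull σ h.2.1 then notInvest else conditional i (σ i) h
  have hb₀ : IsAdapted σ b₀ :=
    ⟨fun i t a x h => if_pos h, fun i t a x h _ => if_neg h⟩
  let D := fun i => historyProcess G i _ (isWeight_weight i (b₀ (1 - i)))
  have hnull : ∀ i (s : Σ t, PrivateHistory X t), IsNull σ s.2.1 →
      ∀ τ τ' : BehavioralStrategy X, (∀ s ∈ {s : Σ t, PrivateHistory X t | IsNull σ s.2.1},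
        τ' s = notInvest) → (D i).value τ s ≤ (D i).value τ' s := by
    rintro i ⟨t, a, x⟩ h τ τ' hτ'
    rw [← sum_jointWeight_mul_continuationValue G i b₀ τ _ (fun _ _ _ => rfl),
      ← sum_jointWeight_mul_continuationValue G i b₀ τ' _ (fun _ _ _ => rfl)]
    refine Finset.sum_le_sum fun q _ => mul_le_mul_of_nonneg_left ?_
      (jointWeight_nonneg (isWeight_weight i (b₀ (1 - i))) a x q)
    rw [continuationValue_eq_zero G (σ := σ) (b := Function.update b₀ i τ') (fun t a x h => by
      rw [Function.update_self]; exact hτ' ⟨t, a, x⟩ h) q.1 a h]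
    exact continuationValue_nonpos G (σ := σ) (fun t a x h => by
      rw [Function.update_of_ne (one_sub_ne i)]; exact hb₀.null _ t a x h) q.1 a h _
  -- Not investing at null nodes is required here so that the payoff of `τ i` against `σ` is its
  -- value against `b₀`.
  choose τ hτ hopt using fun i => (D i).exists_optimal
    {s : Σ t, PrivateHistory X t | IsNull σ s.2.1} (fun _ => notInvest) (hnull i)
  let b : Player → BehavioralStrategy X := fun i h =>
    if IsNull σ h.2.1 then notInvest
    else if 0 < mixedWeight i (σ i) h.2.1 (Fin.init h.2.2) then conditional i (σ i) h
    else τ i h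
  have hb : IsAdapted σ b := ⟨fun i t a x h => if_pos h, fun i t a x h hpos => by
    simp only [b, if_neg h, if_pos hpos]⟩
  have hw : ∀ i, (fun t (a : Fin t → Profile) x => weight (1 - i) (b (1 - i)) a x) =
      fun t (a : Fin t → Profile) x => weight (1 - i) (b₀ (1 - i)) a x := fun i => by
    funext t a x
    exact hb.weight_congr hb₀ _ a x
  refine ⟨b, hb, fun i τ' s => ?_⟩
  simp only [hw i]
  change (D i).value τ' s ≤ (D i).value (b i) s
  refine (hopt i τ' s).trans ?_
  -- The Nash property compares sums over the first signal. As `τ i` is at least as good at every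
  -- first signal, equality holds for each.
  have hroot : ∀ x : Fin 1 → X, (D i).value (τ i) ⟨0, Fin.elim0, x⟩ ≤
      (D i).value (b i) ⟨0, Fin.elim0, x⟩ := by
    have h := hσ i (BehavioralStrategy.toMixed (τ i))
    rw [payoff_update_of_isAdapted G hb₀ i (isWeight_weight i (b₀ (1 - i))) (fun _ _ _ => rfl)
      (fun t a x h => hτ i ⟨t, a, x⟩ h), payoff_eq_of_isAdapted G hb i
      (isWeight_weight i (b₀ (1 - i))) (fun _ _ _ => hb₀.weight_congr hb _ _ _)] at h
    have h2 := (Finset.sum_eq_sum_iff_of_le fun x _ => hopt i (b i) ⟨0, Fin.elim0, x⟩).1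
      (le_antisymm (Finset.sum_le_sum fun x _ => hopt i (b i) ⟨0, Fin.elim0, x⟩) h)
    exact fun x => (h2 x (Finset.mem_univ x)).ge
  have hreach : ∀ t (a : Fin t → Profile) (x : Fin (t + 1) → X),
      0 < weight i (b i) a (Fin.init x) →
        (D i).value (τ i) ⟨t, a, x⟩ ≤ (D i).value (b i) ⟨t, a, x⟩ := by
    intro t
    induction t with
    | zero =>
      intro a x _
      rw [Subsingleton.elim a Fin.elim0]
      exact hroot x
    | succ t ih =>
      intro a x hpos
      obtain ⟨a, α, rfl⟩ := exists_eq_snoc a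
      obtain ⟨x, y, rfl⟩ := exists_eq_snoc x
      rw [Fin.init_snoc (α := fun _ => X), weight_snoc] at hpos
      have h1 : 0 < weight i (b i) a (Fin.init x) :=
        (weight_nonneg _ _ _ _).lt_of_ne' (left_ne_zero_of_mul hpos.ne')
      have h2 : 0 < b i ⟨t, a, x⟩ (α i) :=
        (stdSimplex.zero_le _ _).lt_of_ne' (right_ne_zero_of_mul hpos.ne')
      have h3 := (D i).value_le_next (hopt i) (ih a x h1) h2 (α (1 - i), y)
      have h4 : (D i).next ⟨t, a, x⟩ (α i) (α (1 - i), y) =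
          ⟨t + 1, Fin.snoc (α := fun _ => Profile) a α, Fin.snoc (α := fun _ => X) x y⟩ := by
        change (⟨t + 1, Fin.snoc (α := fun _ => Profile) a (pair i (α i) (α (1 - i))),
          Fin.snoc (α := fun _ => X) x y⟩ : Σ t, PrivateHistory X t) = _
        rw [pair_eta]
      rwa [h4] at h3
  -- `b i` is optimal at null nodes by `hnull` and at nodes of positive own weight by `hreach`; at
  -- all others it copies `τ i`.
  refine (D i).value_le_of_agree (fun s => ?_) s
  obtain ⟨t, a, x⟩ := s
  by_cases h : IsNull σ a
  · exact Or.inl (hnull i _ h _ _ fun s hs => if_pos hs)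
  · by_cases hpos : 0 < mixedWeight i (σ i) a (Fin.init x)
    · exact Or.inl (hreach t a x (by rwa [hb.weight_eq i a h]))
    · exact Or.inr (by simp only [b, if_neg h, if_neg hpos])

end Equilibrium

end InvestmentGame

end

/-! ### Trembles, beliefs and sequential rationality -/

noncomputable section

namespace InvestmentGame

variable {X : Type*}

theorem tendsto_simplex_iff {ι α : Type*} [Fintype α] {l : Filter ι} {u : ι → stdSimplex ℝ α}
    {p : stdSimplex ℝ α} :
    Tendsto u l (𝓝 p) ↔ ∀ a, Tendsto (fun n => u n a) l (𝓝 (p a)) := by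
  rw [tendsto_subtype_rng, tendsto_pi_nhds]
  rfl

/-- The mixture of a distribution over actions with the uniform distribution. -/
def tremble (ε : Set.Icc (0 : ℝ) 1) (p : stdSimplex ℝ Action) : stdSimplex ℝ Action :=
  ⟨fun a => (1 - ε) * p a + ε / 2, fun a => add_nonneg
    (mul_nonneg (sub_nonneg.2 ε.2.2) (stdSimplex.zero_le p a)) (div_nonneg ε.2.1 zero_le_two), by
    rw [Finset.sum_add_distrib, ← Finset.mul_sum, stdSimplex.sum_eq_one, Finset.sum_const,
      Finset.card_univ, show Fintype.card Action = 2 from rfl, nsmul_eq_mul, Nat.cast_ofNat]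
    ring⟩

theorem weight_pos {b : Player → BehavioralStrategy X} (hb : CompletelyMixed b) (i : Player)
    {t : ℕ} (a : Fin t → Profile) (x : Fin t → X) : 0 < weight i (b i) a x :=
  Finset.prod_pos fun _ _ => hb i _ _

theorem tendsto_weight {b : Player → BehavioralStrategy X}
    {bs : ℕ → Player → BehavioralStrategy X}
    (h : ∀ i s, Tendsto (fun n => bs n i s) atTop (𝓝 (b i s))) (i : Player) {t : ℕ}
    (a : Fin t → Profile) (x : Fin t → X) :
    Tendsto (fun n => weight i (bs n i) a x) atTop (𝓝 (weight i (b i) a x)) :=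
  tendsto_finsetProd _ fun _ _ => tendsto_simplex_iff.1 (h i _) _

section Beliefs

variable [Fintype X] (G : Game X)

theorem jointWeight_sum_pos {w : ∀ t, (Fin t → Profile) → (Fin t → X) → ℝ} {i : Player}
    (hw : IsWeight i w) {t : ℕ} (a : Fin t → Profile) (x : Fin (t + 1) → X)
    {y : Fin t → X} (hy : 0 < w t a y) : 0 < ∑ q, jointWeight G w a x q := by
  refine Finset.sum_pos' (fun q _ => jointWeight_nonneg hw a x q)
    -- The weight ignores the opponent's last signal, so `x 0` stands for an arbitrary one.
    ⟨(State.H, Fin.snoc (α := fun _ => X) y (x 0)), Finset.mem_univ _, ?_⟩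
  refine mul_pos (prior_mul_prod_pos G x _) ?_
  rwa [Fin.init_snoc (α := fun _ => X)]

/-- The beliefs given by Bayes' rule. -/
def bayes {b : Player → BehavioralStrategy X} (hb : CompletelyMixed b) (i : Player) :
    BeliefFunction X := fun h =>
  ⟨fun q => jointWeight G (fun _ a x => weight (1 - i) (b (1 - i)) a x) h.2.1 h.2.2 q /
      ∑ q, jointWeight G (fun _ a x => weight (1 - i) (b (1 - i)) a x) h.2.1 h.2.2 q,
    fun q => div_nonneg (jointWeight_nonneg (isWeight_weight i (b (1 - i))) _ _ q)
      (Finset.sum_nonneg fun q _ => jointWeight_nonneg (isWeight_weight i (b (1 - i))) _ _ q), by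
    rw [← Finset.sum_div]
    exact div_self (jointWeight_sum_pos G (isWeight_weight i (b (1 - i))) h.2.1 h.2.2
      (weight_pos hb (1 - i) h.2.1 (Fin.init h.2.2))).ne'⟩

/-- The event of a private history is the disjoint union, over states and opponent signals, of
truncation events. The own weight is a common factor of their probabilities and cancels. -/
theorem inducedBeliefs_bayes [MeasurableSpace X] [DiscreteMeasurableSpace X]
    {b : Player → BehavioralStrategy X} (hb : CompletelyMixed b) :
    G.InducedBeliefs b (bayes G hb) := by
  rintro i ⟨t, a, x⟩ θ y
  let A : State × (Fin (t + 1) → X) → Set (Path X) := fun q =>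
    {ω | truncate (t + 1) t ω = (q.1, joinSignals i x q.2, a)}
  have hA : ∀ q, A q = {ω | privateHistory i t ω = (a, x)} ∩
      {ω | ω.1 = q.1 ∧ (privateHistory (1 - i) t ω).2 = q.2} := by
    intro q
    ext ω
    simp only [A, truncate, privateHistory, Set.mem_ofPred_eq, Set.mem_inter_iff, Prod.mk.injEq]
    have : (fun k : Fin (t + 1) => ω.2.1 k) = joinSignals i x q.2 ↔
        (fun k : Fin (t + 1) => ω.2.1 k i) = x ∧
          (fun k : Fin (t + 1) => ω.2.1 k (1 - i)) = q.2 := by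
      constructor
      · intro h
        exact ⟨funext fun k => by rw [congrFun h k, joinSignals_self],
          funext fun k => by rw [congrFun h k, joinSignals_opp]⟩
      · rintro ⟨rfl, h⟩
        funext k
        rw [← h]
        exact (pair_eta i (ω.2.1 k)).symm
    rw [this]
    tauto
  have hmA : ∀ q, MeasurableSet (A q) := fun q =>
    measurable_truncate (t + 1) t (MeasurableSet.singleton _)
  have hU : {ω : Path X | privateHistory i t ω = (a, x)} = ⋃ q, A q := by
    ext ω
    simp only [hA, Set.mem_iUnion, Set.mem_inter_iff]
    exact ⟨fun h => ⟨(ω.1, (privateHistory (1 - i) t ω).2), h, rfl, rfl⟩, fun ⟨_, h, _⟩ => h⟩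
  have hdisj : Pairwise (Function.onFun Disjoint A) := by
    intro q q' hq
    rw [Function.onFun, Set.disjoint_left]
    intro ω hω hω'
    rw [hA] at hω hω'
    exact hq (Prod.ext (hω.2.1.symm.trans hω'.2.1) (hω.2.2.symm.trans hω'.2.2))
  have hPA : ∀ q, (G.behavioralPathLaw b).real (A q) = weight i (b i) a (Fin.init x) *
      jointWeight G (fun _ a x => weight (1 - i) (b (1 - i)) a x) a x q := by
    intro q
    rw [Game.behavioralPathLaw, pathLaw_truncate G _ (Nat.le_succ t), historyProb]
    simp only [toMixed_compatible, prod_player i, joinSignals_self, joinSignals_opp,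
      Finset.prod_mul_distrib, jointWeight]
    change _ * (weight i (b i) a (Fin.init x) * weight (1 - i) (b (1 - i)) a (Fin.init q.2)) = _
    ring
  have hm : MeasurableSet {ω : Path X | privateHistory i t ω = (a, x)} :=
    hU ▸ MeasurableSet.iUnion hmA
  have hfin : IsFiniteMeasure (G.behavioralPathLaw b) := by
    unfold Game.behavioralPathLaw; infer_instance
  rw [measureReal_def, cond_apply hm, ENNReal.toReal_mul, ENNReal.toReal_inv, ← measureReal_def,
    ← measureReal_def, ← hA (θ, y), hPA, hU, measureReal_iUnion_fintype hdisj hmA]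
  simp only [hPA]
  rw [← Finset.mul_sum]
  have h1 := (weight_pos hb i a (Fin.init x)).ne'
  change jointWeight G _ a x (θ, y) / ∑ q, jointWeight G _ a x q = _
  rw [← div_eq_inv_mul, mul_div_mul_left _ _ h1]

theorem tendsto_jointWeight {b : Player → BehavioralStrategy X}
    {bs : ℕ → Player → BehavioralStrategy X}
    (h : ∀ i s, Tendsto (fun n => bs n i s) atTop (𝓝 (b i s))) (i : Player) {t : ℕ}
    (a : Fin t → Profile) (x : Fin (t + 1) → X) (q : State × (Fin (t + 1) → X)) :
    Tendsto (fun n => jointWeight G (fun _ a x => weight i (bs n i) a x) a x q) atTop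
      (𝓝 (jointWeight G (fun _ a x => weight i (b i) a x) a x q)) :=
  (tendsto_weight h i a (Fin.init q.2)).const_mul _

/-- Every behavioral profile is part of a consistent assessment, whose beliefs are given by Bayes'
rule where possible. -/
theorem exists_consistent [MeasurableSpace X] [DiscreteMeasurableSpace X]
    (b : Player → BehavioralStrategy X) :
    ∃ μ : Player → BeliefFunction X, G.Consistent b μ ∧
      ∀ i t (a : Fin t → Profile) (x : Fin (t + 1) → X),
        0 < ∑ q, jointWeight G (fun _ a x => weight (1 - i) (b (1 - i)) a x) a x q →
        ∀ q, μ i ⟨t, a, x⟩ q =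
          jointWeight G (fun _ a x => weight (1 - i) (b (1 - i)) a x) a x q /
          ∑ q, jointWeight G (fun _ a x => weight (1 - i) (b (1 - i)) a x) a x q := by
  have hε : ∀ n : ℕ, 1 / ((n : ℝ) + 1) ∈ Set.Icc (0 : ℝ) 1 := fun n =>
    ⟨by positivity, (div_le_one (by positivity)).2 (by linarith [n.cast_nonneg (α := ℝ)])⟩
  let bs : ℕ → Player → BehavioralStrategy X := fun n i s => tremble ⟨_, hε n⟩ (b i s)
  have hbs : ∀ n, CompletelyMixed (bs n) := fun n i s α => by
    change 0 < (1 - 1 / ((n : ℝ) + 1)) * b i s α + 1 / ((n : ℝ) + 1) / 2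
    have h1 := mul_nonneg (sub_nonneg.2 (hε n).2) (stdSimplex.zero_le (b i s) α)
    have h2 : 0 < 1 / ((n : ℝ) + 1) / 2 := by positivity
    linarith
  have hlim : ∀ i s, Tendsto (fun n => bs n i s) atTop (𝓝 (b i s)) := fun i s => by
    refine tendsto_simplex_iff.2 fun α => ?_
    have h := tendsto_one_div_add_atTop_nhds_zero_nat (𝕜 := ℝ)
    have h' := ((h.const_sub 1).mul_const (b i s α)).add (h.div_const 2)
    rw [sub_zero, one_mul, zero_div, add_zero] at h'
    exact h'
  -- The space of belief functions is a countable product of simplices, hence sequentially compact;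
  -- a single subsequence serves all histories.
  obtain ⟨μ, -, φ, hφ, hμ⟩ := isCompact_univ.tendsto_subseq
    (x := fun n => (fun i => bayes G (hbs n) i : Player → BeliefFunction X))
    fun n => Set.mem_univ _
  have hμ' : ∀ i h, Tendsto (fun n => bayes G (hbs (φ n)) i h) atTop (𝓝 (μ i h)) := fun i h =>
    tendsto_pi_nhds.1 (tendsto_pi_nhds.1 hμ i) h
  have hlim' : ∀ i s, Tendsto (fun n => bs (φ n) i s) atTop (𝓝 (b i s)) := fun i s =>
    (hlim i s).comp hφ.tendsto_atTop
  refine ⟨μ, ⟨fun n => bs (φ n), fun n => bayes G (hbs (φ n)), fun n => hbs _,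
    fun n => inducedBeliefs_bayes G (hbs _), fun i h => (hμ' i h).prodMk_nhds (hlim' i h)⟩, ?_⟩
  intro i t a x hpos q
  refine tendsto_nhds_unique (tendsto_simplex_iff.1 (hμ' i ⟨t, a, x⟩) q) ?_
  exact (tendsto_jointWeight G hlim' (1 - i) a x q).div
    (tendsto_finsetSum _ fun q _ => tendsto_jointWeight G hlim' (1 - i) a x q) hpos.ne'

/-- After null sequences any belief will do. Otherwise the opponent's weight is positive for some
signals, the belief is the normalized joint weight, and the objective is the value in the decision
process divided by the mass. -/
theorem sequentiallyRational_of_optimal {σ : Player → MixedStrategy X}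
    {b : Player → BehavioralStrategy X} (hb : IsAdapted σ b)
    (hopt : ∀ i (τ : BehavioralStrategy X) s,
      (historyProcess G i _ (isWeight_weight i (b (1 - i)))).value τ s ≤
        (historyProcess G i _ (isWeight_weight i (b (1 - i)))).value (b i) s)
    {μ : Player → BeliefFunction X}
    (hμ : ∀ i t (a : Fin t → Profile) (x : Fin (t + 1) → X),
      0 < ∑ q, jointWeight G (fun _ a x => weight (1 - i) (b (1 - i)) a x) a x q →
      ∀ q, μ i ⟨t, a, x⟩ q =
        jointWeight G (fun _ a x => weight (1 - i) (b (1 - i)) a x) a x q /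
        ∑ q, jointWeight G (fun _ a x => weight (1 - i) (b (1 - i)) a x) a x q) :
    G.SequentiallyRational b μ := by
  rintro i ⟨t, a, x⟩ τ
  by_cases h : IsNull σ a
  · refine Finset.sum_le_sum fun q _ => mul_le_mul_of_nonneg_left ?_ (stdSimplex.zero_le _ _)
    dsimp only
    rw [continuationValue_eq_zero G (hb.null i) q.1 a h]
    exact continuationValue_nonpos G (σ := σ) (fun t a x h => by
      rw [Function.update_of_ne (one_sub_ne i)]; exact hb.null _ t a x h) q.1 a h _
  · have hy : ∃ y, 0 < weight (1 - i) (b (1 - i)) a y := by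
      by_contra! hy
      refine h ⟨1 - i, fun y => ?_⟩
      rw [← hb.weight_eq (1 - i) a h]
      exact le_antisymm (hy y) (weight_nonneg _ _ _ _)
    obtain ⟨y, hy⟩ := hy
    have hpos := jointWeight_sum_pos G (isWeight_weight i (b (1 - i))) a x hy
    have key : ∀ τ : BehavioralStrategy X,
        G.expectedContinuationValue i (Function.update b i τ) ⟨t, a, x⟩ (μ i ⟨t, a, x⟩) =
        (historyProcess G i _ (isWeight_weight i (b (1 - i)))).value τ ⟨t, a, x⟩ /
          ∑ q, jointWeight G (fun _ a x => weight (1 - i) (b (1 - i)) a x) a x q := by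
      intro τ
      rw [← sum_jointWeight_mul_continuationValue G i b τ _ (fun _ _ _ => rfl), Finset.sum_div]
      refine Finset.sum_congr rfl fun q _ => ?_
      rw [hμ i t a x hpos q, div_mul_eq_mul_div]
    have h1 := key (b i)
    rw [Function.update_eq_self] at h1
    rw [key, h1]
    exact div_le_div_of_nonneg_right (hopt i τ _) hpos.le

end Beliefs

end InvestmentGame

end

/-- Every mixed strategy Nash equilibrium has an outcome equivalent sequential equilibrium. -/
theorem mainTheorem5 {X : Type*} [Fintype X] [MeasurableSpace X] [DiscreteMeasurableSpace X]
    (G : InvestmentGame.Game X) (σ : InvestmentGame.Player → InvestmentGame.MixedStrategy X)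
    (hσ : G.IsNash σ) :
    ∃ (b : InvestmentGame.Player → InvestmentGame.BehavioralStrategy X)
      (μ : InvestmentGame.Player → InvestmentGame.BeliefFunction X),
      G.OutcomeEquivalent σ b ∧ G.IsSequentialEquilibrium b μ := by
  obtain ⟨b, hb, hopt⟩ := InvestmentGame.exists_isAdapted_optimal G hσ
  obtain ⟨μ, hcons, hμ⟩ := InvestmentGame.exists_consistent G b
  exact ⟨b, μ, hb.outcomeEquivalent G,
    InvestmentGame.sequentiallyRational_of_optimal G hb hopt hμ, hcons⟩
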